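/- **Notation.** Let $f_1,\dots,f_m\in L^2(\mathbb R^d)$ be complex-valued functions and let $\mathcal F=\{f_1,\dots,f_m\}$. For a finite family $\Phi=\{\varphi_1,\dots,\varphi_s\}\subset L^2(\mathbb R^d)$, let $\mathcal S(\Phi)$ denote the closed linear span in $L^2(\mathbb R^d)$ of $\{\varphi_i(\cdot-k): 1\le i\le s,\ k\in\mathbb Z^d\}$, and let $\mathcal V_n$ be the set of all subspaces of the form $\mathcal S(\Phi)$ where $\Phi$ has at most $n$ elements. A space $V\in\mathcal V_n$ is called *optimal* if $$\sum_{i=1}^m\|f_i-P_Vf_i\|^2\le\sum_{i=1}^m\|f_i-P_{V'}f_i\|^2\qquad\text{for all } V'\in\mathcal V_n,$$ where $P_W$ is the orthogonal projection onto $W$. Let $\hat f$ be the Fourier transform on $L^2(\mathbb R^d)$, normalized by $\hat f(\omega)=\int_{\mathbb R^d} f(x)e^{-2\pi i x\cdot\omega}\,dx$. The Gramian of $\mathcal F$ is the $m\times m$ matrix $$[G_{\mathcal F}(\omega)]_{i,j}=\sum_{k\in\mathbb Z^d}\hat f_i(\omega+k)\overline{\hat f_j(\omega+k)},\qquad \text{defined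 for a.e. }\omega\in\mathbb R^d,$$ with eigenvalues $\lambda_1(\omega)\ge\dots\ge\lambda_m(\omega)\ge 0$, counted with multiplicity. Put $\tilde\sigma_i(\omega)=\lambda_i(\omega)^{-1/2}$ if $\lambda_i(\omega)\neq0$ and $\tilde\sigma_i(\omega)=0$ otherwise. **Theorem.** Let $1\le n<m$ and suppose that $\lambda_n(\omega)>\lambda_{n+1}(\omega)$ for almost every $\omega$. Then: 1. There is exactly one optimal space $V\in\mathcal V_n$. 2. $n\le \operatorname{rank}G_{\mathcal F}(\omega)$ for almost every $\omega$; that is, $n$ is at most the essential minimum of $\operatorname{rank}G_{\mathcal F}(\omega)$ over $\omega\in[0,1]^d$. 3. There exist measurable functions $y_1,\dots,y_n:\mathbb R^d\to\mathbb C^m$ that are $\mathbb Z^d$-periodic (up to null sets) and such that, for almost every $\omega$, the vectors $y_1(\omega),\dots,y_n(\omega)$ are orthonormal and satisfy $y_i(\omega)^tG_{\mathcal F}(\omega)=\lambda_i(\omega)\,y_i(\omega)^t$ for $1\le i\le n$. For every such choice of $y_i=(y_{i1},\dots,y_{im})^t$, there are functions $\varphi_1,\dots,\varphi_n\in L^2(\mathbb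 R^d)$ with $$\hat\varphi_i(\omega)=\tilde\sigma_i(\omega)\sum_{j=1}^m y_{ij}(\omega)\hat f_j(\omega)\quad\text{for a.e. }\omega\in\mathbb R^d,\qquad i=1,\dots,n,$$ and the integer translates $\{\varphi_i(\cdot-k): 1\le i\le n,\ k\in\mathbb Z^d\}$ form an orthonormal basis of $V$. -/

import Mathlib

open MeasureTheory FourierTransform
open scoped Matrix ComplexConjugate

namespace FSIS

noncomputable section

/-- `ℝᵈ` with its Euclidean structure. -/
abbrev Space (d : ℕ) := EuclideanSpace ℝ (Fin d)

/-- `L²(ℝᵈ)`: complex-valued square-integrable functions modulo a.e. equality, for Lebesgue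
measure. -/
abbrev L2 (d : ℕ) := Lp (α := Space d) ℂ 2 volume

/-- The lattice vector `k ∈ ℤᵈ` as an element of `ℝᵈ`. -/
def latticeVec {d : ℕ} (k : Fin d → ℤ) : Space d :=
  WithLp.toLp 2 (fun i => (k i : ℝ))

/-- The integer translate `φ(· - k)` of `φ ∈ L²(ℝᵈ)`. -/
def translate {d : ℕ} (k : Fin d → ℤ) (φ : L2 d) : L2 d :=
  Lp.compMeasurePreserving (fun x : Space d => x - latticeVec k)
    (measurePreserving_sub_right volume (latticeVec k)) φ

/-- The system of integer translates `φ_i(· - k)`, indexed by the pairs `(i, k)`. -/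
def translates {d : ℕ} {ι : Type*} (Φ : ι → L2 d) (p : ι × (Fin d → ℤ)) : L2 d :=
  translate p.2 (Φ p.1)

/-- The shift-invariant space `S(Φ)`: the closed linear span in `L²(ℝᵈ)` of the integer translates
of the functions in `Φ`. -/
def shiftInvariantSpace {d : ℕ} {ι : Type*} (Φ : ι → L2 d) : ClosedSubmodule ℂ (L2 d) :=
  (Submodule.span ℂ (Set.range (translates Φ))).closure

/-- `𝒱_n`: the shift-invariant spaces of length at most `n`, i.e. those that have a set of `s`
generators for some `s ≤ n`. -/
def spacesOfLengthLE (d n : ℕ) : Set (ClosedSubmodule ℂ (L2 d)) :=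
  {V | ∃ s : ℕ, s ≤ n ∧ ∃ Φ : Fin s → L2 d, V = shiftInvariantSpace Φ}

/-- Closed subspaces of `L²(ℝᵈ)` have an orthogonal projection. -/
instance instHasOrthogonalProjection {d : ℕ} (V : ClosedSubmodule ℂ (L2 d)) :
    V.toSubmodule.HasOrthogonalProjection :=
  haveI : CompleteSpace V.toSubmodule := V.isClosed.completeSpace_coe
  inferInstance

/-- The least squares error `∑ᵢ ‖fᵢ - P_V fᵢ‖²`, where `P_V` is the orthogonal projection
onto `V`. -/
def error {d m : ℕ} (f : Fin m → L2 d) (V : ClosedSubmodule ℂ (L2 d)) : ℝ :=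
  ∑ i, ‖f i - V.toSubmodule.starProjection (f i)‖ ^ 2

/-- `V` is an optimal space for the data `f`: it lies in `𝒱_n` and minimizes the least squares
error over `𝒱_n`. -/
def IsOptimal {d m : ℕ} (f : Fin m → L2 d) (n : ℕ) (V : ClosedSubmodule ℂ (L2 d)) : Prop :=
  V ∈ spacesOfLengthLE d n ∧ ∀ V' ∈ spacesOfLengthLE d n, error f V ≤ error f V'

/-- The Gramian `[G_f(ω)]_{ij} = ∑_{k ∈ ℤᵈ} f̂ᵢ(ω + k) conj (f̂ⱼ(ω + k))`. Here `𝓕` is the Fourier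
transform on `L²`, the isometric extension of `f̂(ω) = ∫ f(x) exp(-2πi x·ω) dx`; a representative
of each `f̂ᵢ` is used, so that `G_f` is meaningful up to null sets. -/
def gramian {d m : ℕ} (f : Fin m → L2 d) (ω : Space d) : Matrix (Fin m) (Fin m) ℂ :=
  Matrix.of fun i j => ∑' k : Fin d → ℤ,
    (𝓕 (f i) : L2 d) (ω + latticeVec k) * conj ((𝓕 (f j) : L2 d) (ω + latticeVec k))

theorem gramian_isHermitian {d m : ℕ} (f : Fin m → L2 d) (ω : Space d) :
    (gramian f ω).IsHermitian := by
  ext i j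
  simp only [gramian, Matrix.conjTranspose_apply, Matrix.of_apply, tsum_star]
  refine tsum_congr fun k => ?_
  simp [mul_comm]

/-- The eigenvalues of the Gramian, with multiplicity and in decreasing order. The index starts
at `0`: `eigenvalue f ω i` is what is usually written `λ_{i+1}(ω)`. -/
def eigenvalue {d m : ℕ} (f : Fin m → L2 d) (ω : Space d) (i : Fin m) : ℝ :=
  (gramian_isHermitian f ω).eigenvalues₀ (Fin.cast (Fintype.card_fin m).symm i)

/-- `σ̃_i(ω) = λ_i(ω)^{-1/2}` where `λ_i(ω) ≠ 0`, and `0` elsewhere. -/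
def sigmaTilde {d m : ℕ} (f : Fin m → L2 d) (ω : Space d) (i : Fin m) : ℝ :=
  if eigenvalue f ω i = 0 then 0 else eigenvalue f ω i ^ (-(1 / 2) : ℝ)

/-- A choice of measurable, `ℤᵈ`-periodic left eigenvectors `y_1(ω), …, y_n(ω)` of the Gramian
that belong to its first `n` eigenvalues and are orthonormal in `ℂᵐ` for almost every `ω`. -/
structure IsEigenvectorChoice {d m n : ℕ} (f : Fin m → L2 d) (hnm : n ≤ m)
    (y : Fin n → Space d → EuclideanSpace ℂ (Fin m)) : Prop where
  measurable : ∀ i, Measurable (y i)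
  periodic : ∀ i (k : Fin d → ℤ), ∀ᵐ ω, y i (ω + latticeVec k) = y i ω
  orthonormal : ∀ᵐ ω, Orthonormal ℂ (fun i => y i ω)
  left_eigenvector : ∀ i, ∀ᵐ ω, (y i ω).ofLp ᵥ* gramian f ω =
    (eigenvalue f ω (Fin.castLE hnm i) : ℂ) • (y i ω).ofLp

/-- The functions `φ_1, …, φ_n ∈ L²(ℝᵈ)` satisfy
`φ̂_i(ω) = σ̃_i(ω) ∑ⱼ y_{ij}(ω) f̂ⱼ(ω)` for almost every `ω ∈ ℝᵈ`. -/
def AreConstructedGenerators {d m n : ℕ} (f : Fin m → L2 d) (hnm : n ≤ m)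
    (y : Fin n → Space d → EuclideanSpace ℂ (Fin m)) (φ : Fin n → L2 d) : Prop :=
  ∀ i, ∀ᵐ ω, (𝓕 (φ i) : L2 d) ω =
    (sigmaTilde f ω (Fin.castLE hnm i) : ℂ) * ∑ j, y i ω j * (𝓕 (f j) : L2 d) ω

/-- The integer translates of `φ_1, …, φ_n` form an orthonormal basis of `V`: they are an
orthonormal family (indexed by the pairs `(i, k)`) whose closed linear span is `V`. -/
def TranslatesAreOrthonormalBasis {d n : ℕ} (φ : Fin n → L2 d)
    (V : ClosedSubmodule ℂ (L2 d)) : Prop :=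
  Orthonormal ℂ (translates φ) ∧
    (Submodule.span ℂ (Set.range (translates φ))).closure = V

end

end FSIS

open FSIS

/-! The Fourier transform turns a function into its field of fibers $(\hat
g(\omega+k))_k\in\ell^2(\mathbb Z^d)$ over the unit cube. This is an isometry
(`integral_inner_fiber`), and a translate only multiplies each fiber by a character
(`fiber_translate`). So orthogonality to all translates of $g$ says that an integrable function on
the cube has vanishing Fourier coefficients, i.e. that the fibers are orthogonal almost everywhere.
It follows that projection onto a shift-invariant space acts fiber by fiber, as projection onto the
span of the generators' fibers (`fiber_starProjection`), and that the space is determined by these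
spans (`mem_shiftInvariantSpace_iff`).

The error is therefore a constant minus the integral over the cube of the energy captured in each
fiber. At a fixed $\omega$ the problem is to approximate $m$ vectors with Gram matrix $G(\omega)$ by
a subspace of dimension at most $n$. Eckart–Young bounds the captured energy by
$\lambda_1+\dots+\lambda_n$, and the gap $\lambda_n>\lambda_{n+1}$ leaves only one subspace
attaining the bound (`exists_unique_best_subspace`). The gap also forces $\lambda_n>0$, which is the
rank statement.

Attaining the bound in almost every fiber requires measurable periodic eigenvectors. They are
selected measurably on the space of Hermitian matrices (`exists_measurable_eigenvectors`) and then
composed with the Gramian, so that periodicity is automatic. For any choice of eigenvectors the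
generators $\varphi_i$ have as fibers the normalized singular vectors. These are orthonormal, so the
translates are orthonormal, and they attain the bound, so the span is optimal. An optimal space has
almost everywhere the same captured energy, hence the same fiber spaces, and so is the same space.
Thus all choices of eigenvectors give one $V$. -/

namespace FSIS

noncomputable section

open Filter Topology
open scoped ENNReal InnerProductSpace ComplexOrder

/-! ### Periodization -/

/-- The half-open unit cube `(0, 1]ᵈ`, a fundamental domain of `ℤᵈ` in `ℝᵈ`. -/
def cube (d : ℕ) : Set (Space d) := {x | ∀ i, x i ∈ Set.Ioc (0 : ℝ) (0 + 1)}

/-- Lebesgue measure on the unit cube. -/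
abbrev cubeMeasure (d : ℕ) : Measure (Space d) := volume.restrict (cube d)

theorem measurableSet_cube (d : ℕ) : MeasurableSet (cube d) := by
  have : cube d = ⋂ i, (fun x : Space d => x i) ⁻¹' Set.Ioc (0 : ℝ) (0 + 1) := by
    ext x; simp [cube]
  rw [this]
  exact MeasurableSet.iInter fun i => (by fun_prop : Measurable fun x : Space d => x i)
    measurableSet_Ioc

@[simp] theorem latticeVec_apply {d : ℕ} (k : Fin d → ℤ) (i : Fin d) :
    latticeVec k i = k i := rfl

theorem latticeVec_add {d : ℕ} (k l : Fin d → ℤ) :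
    latticeVec (k + l) = latticeVec k + latticeVec l := by
  ext i; simp

theorem latticeVec_neg {d : ℕ} (k : Fin d → ℤ) : latticeVec (-k) = -latticeVec k := by
  ext i; simp

theorem cube_translates_disjoint {d : ℕ} : Pairwise (Function.onFun Disjoint
    fun k : Fin d → ℤ => (fun x : Space d => x - latticeVec k) ⁻¹' cube d) := by
  intro k l hkl
  refine Set.disjoint_left.2 fun x hx hy => hkl ?_
  funext i
  have h1 := hx i
  have h2 := hy i
  simp only [PiLp.sub_apply, latticeVec_apply, Set.mem_Ioc, zero_add] at h1 h2
  have h3 : (k i : ℝ) < l i + 1 := by linarith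
  have h4 : (l i : ℝ) < k i + 1 := by linarith
  have h5 : k i < l i + 1 := by exact_mod_cast h3
  have h6 : l i < k i + 1 := by exact_mod_cast h4
  omega

theorem iUnion_cube_translates {d : ℕ} :
    ⋃ k : Fin d → ℤ, (fun x : Space d => x - latticeVec k) ⁻¹' cube d = Set.univ := by
  -- The cube is open on the left, so the shift is the ceiling minus one: $x-(\lceil
  -- x\rceil-1)\in(0,1]$ even at integers.
  refine Set.eq_univ_of_forall fun x => Set.mem_iUnion.2 ⟨fun i => ⌈x i⌉ - 1, fun i => ?_⟩
  simp only [PiLp.sub_apply, latticeVec_apply, Set.mem_Ioc, zero_add]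
  push_cast
  constructor
  · linarith [Int.ceil_lt_add_one (x i)]
  · linarith [Int.le_ceil (x i)]

/-- Written as an identity of measures, the tiling by cubes yields the decompositions of null sets,
lower integrals and Bochner integrals below. -/
theorem volume_eq_sum_cube (d : ℕ) : (volume : Measure (Space d)) =
    Measure.sum fun k : Fin d → ℤ => (cubeMeasure d).map (fun x => x + latticeVec k) := by
  rw [← Measure.restrict_univ (μ := (volume : Measure (Space d))), ← iUnion_cube_translates,
    Measure.restrict_iUnion cube_translates_disjoint
      (fun k => (measurable_id.sub_const _) (measurableSet_cube d))]
  congr 1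
  funext k
  have := (measurePreserving_add_right (volume : Measure (Space d))
    (latticeVec k)).restrict_preimage
    (s := (fun x : Space d => x - latticeVec k) ⁻¹' cube d)
    ((measurable_id.sub_const _) (measurableSet_cube d))
  rw [← this.map_eq, ← Set.preimage_comp]
  have h : ((fun x : Space d => x - latticeVec k) ∘ fun x => x + latticeVec k) = id := by
    funext x; simp
  rw [h]; rfl

theorem ae_iff_ae_cube {d : ℕ} {p : Space d → Prop} :
    (∀ᵐ ω, p ω) ↔ ∀ᵐ ω ∂cubeMeasure d, ∀ k : Fin d → ℤ, p (ω + latticeVec k) := by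
  conv_lhs => rw [volume_eq_sum_cube d]
  rw [Measure.ae_sum_iff, ae_all_iff]
  exact forall_congr' fun k => (measurableEmbedding_addRight (latticeVec k)).ae_map_iff

theorem ae_of_ae_cube_of_periodic {d : ℕ} {p : Space d → Prop} (h : ∀ᵐ ω ∂cubeMeasure d, p ω)
    (hp : ∀ ω (k : Fin d → ℤ), p ω → p (ω + latticeVec k)) : ∀ᵐ ω, p ω :=
  ae_iff_ae_cube.2 (h.mono fun ω hω k => hp ω k hω)

theorem lintegral_eq_cube {d : ℕ} (F : Space d → ℝ≥0∞) :
    ∫⁻ x, F x = ∑' k : Fin d → ℤ, ∫⁻ ω, F (ω + latticeVec k) ∂cubeMeasure d := by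
  conv_lhs => rw [volume_eq_sum_cube d]
  rw [lintegral_sum_measure]
  exact tsum_congr fun k => (measurableEmbedding_addRight (latticeVec k)).lintegral_map _

theorem integral_eq_cube {d : ℕ} {F : Space d → ℂ} (hF : Integrable F) :
    ∫ x, F x = ∑' k : Fin d → ℤ, ∫ ω, F (ω + latticeVec k) ∂cubeMeasure d := by
  conv_lhs => rw [volume_eq_sum_cube d]
  rw [integral_sum_measure (by rwa [← volume_eq_sum_cube d])]
  exact tsum_congr fun k => (measurableEmbedding_addRight (latticeVec k)).integral_map _

theorem quasiMeasurePreserving_add_latticeVec {d : ℕ} (k : Fin d → ℤ) :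
    Measure.QuasiMeasurePreserving (fun x : Space d => x + latticeVec k) (cubeMeasure d) volume :=
  (measurePreserving_add_right volume (latticeVec k)).quasiMeasurePreserving.mono_left
    Measure.restrict_le_self.absolutelyContinuous

theorem lintegral_cube_tsum {d : ℕ} {F : Space d → ℂ} (hF : AEStronglyMeasurable F) :
    ∫⁻ ω, ∑' k : Fin d → ℤ, ‖F (ω + latticeVec k)‖ₑ ∂cubeMeasure d = ∫⁻ x, ‖F x‖ₑ := by
  rw [lintegral_eq_cube, lintegral_tsum]
  exact fun k => (hF.comp_quasiMeasurePreserving (quasiMeasurePreserving_add_latticeVec k)).enorm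

/-- Tonelli for the norms: the periodized norm has the same finite integral as the norm on $\mathbb
R^d$, hence is finite almost everywhere and dominates the series. -/
theorem integrable_periodization {d : ℕ} {F : Space d → ℂ} (hF : Integrable F) :
    Integrable (fun ω => ∑' k : Fin d → ℤ, F (ω + latticeVec k)) (cubeMeasure d) ∧
      (∀ᵐ ω ∂cubeMeasure d, Summable fun k : Fin d → ℤ => F (ω + latticeVec k)) ∧
      ∫ ω, ∑' k : Fin d → ℤ, F (ω + latticeVec k) ∂cubeMeasure d = ∫ x, F x := by
  have hm : ∀ k : Fin d → ℤ, AEStronglyMeasurable (fun ω => F (ω + latticeVec k))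
      (cubeMeasure d) := fun k =>
    hF.1.comp_quasiMeasurePreserving (quasiMeasurePreserving_add_latticeVec k)
  have hfin : ∫⁻ ω, ∑' k : Fin d → ℤ, ‖F (ω + latticeVec k)‖ₑ ∂cubeMeasure d < ∞ := by
    rw [lintegral_cube_tsum hF.1]; exact hF.2
  have hs : ∀ᵐ ω ∂cubeMeasure d, Summable fun k : Fin d → ℤ => F (ω + latticeVec k) := by
    filter_upwards [ae_lt_top' (AEMeasurable.tsum fun k => (hm k).enorm) hfin.ne]
      with ω hω
    exact Summable.of_enorm hω.ne
  refine ⟨⟨?_, lt_of_le_of_lt (lintegral_mono fun ω => ?_) hfin⟩, hs, ?_⟩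
  · choose G hG hG' using hm
    refine ⟨fun ω => ∑' k, G k ω, .tsum hG, ?_⟩
    filter_upwards [ae_all_iff.2 hG'] with ω hω
    exact tsum_congr hω
  · exact enorm_tsum_le_tsum_enorm
  · rw [integral_eq_cube hF]
    refine integral_tsum hm ?_
    rw [← lintegral_tsum fun k => (hm k).enorm]
    exact hfin.ne

/-! ### Fibers -/

/-- The fiber `(f̂(ω + k))_k` as an element of `ℓ²(ℤᵈ)`; zero where it is not square-summable. -/
def fiber {d : ℕ} (g : L2 d) (ω : Space d) : lp (fun _ : Fin d → ℤ => ℂ) 2 :=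
  open Classical in
  if h : Memℓp (fun k : Fin d → ℤ => (𝓕 g : L2 d) (ω + latticeVec k)) 2 then ⟨_, h⟩ else 0

theorem integrable_inner_fourier {d : ℕ} (g h : L2 d) :
    Integrable fun x => ⟪(𝓕 g : L2 d) x, (𝓕 h : L2 d) x⟫_ℂ :=
  L2.integrable_inner _ _

theorem ae_memℓp {d : ℕ} (g : L2 d) : ∀ᵐ ω ∂cubeMeasure d,
    Memℓp (fun k : Fin d → ℤ => (𝓕 g : L2 d) (ω + latticeVec k)) 2 := by
  filter_upwards [(integrable_periodization (integrable_inner_fourier g g)).2.1] with ω hω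
  rw [memℓp_gen_iff (by norm_num)]
  convert hω.norm using 2 with k
  simp [pow_two]

theorem fiber_apply {d : ℕ} (g : L2 d) : ∀ᵐ ω ∂cubeMeasure d, ∀ k,
    fiber g ω k = (𝓕 g : L2 d) (ω + latticeVec k) := by
  filter_upwards [ae_memℓp g] with ω hω k
  rw [fiber, dif_pos hω]

theorem inner_fiber {d : ℕ} (g h : L2 d) : ∀ᵐ ω ∂cubeMeasure d, ⟪fiber g ω, fiber h ω⟫_ℂ =
    ∑' k : Fin d → ℤ, ⟪(𝓕 g : L2 d) (ω + latticeVec k), (𝓕 h : L2 d) (ω + latticeVec k)⟫_ℂ := by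
  filter_upwards [fiber_apply g, fiber_apply h] with ω hg hh
  rw [lp.inner_eq_tsum]
  simp only [hg, hh]

theorem integrable_inner_fiber {d : ℕ} (g h : L2 d) :
    Integrable (fun ω => ⟪fiber g ω, fiber h ω⟫_ℂ) (cubeMeasure d) :=
  (integrable_congr (inner_fiber g h)).2
    (integrable_periodization (integrable_inner_fourier g h)).1

/-- Plancherel combined with periodization. -/
theorem integral_inner_fiber {d : ℕ} (g h : L2 d) :
    ∫ ω, ⟪fiber g ω, fiber h ω⟫_ℂ ∂cubeMeasure d = ⟪g, h⟫_ℂ := by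
  rw [integral_congr_ae (inner_fiber g h),
    (integrable_periodization (integrable_inner_fourier g h)).2.2, ← L2.inner_def,
    Lp.inner_fourier_eq]

theorem integrable_norm_fiber_sq {d : ℕ} (g : L2 d) :
    Integrable (fun ω => ‖fiber g ω‖ ^ 2) (cubeMeasure d) := by
  refine (integrable_inner_fiber g g).re.congr (ae_of_all _ fun ω => ?_)
  exact inner_self_eq_norm_sq (𝕜 := ℂ) _

theorem integral_norm_fiber_sq {d : ℕ} (g : L2 d) :
    ∫ ω, ‖fiber g ω‖ ^ 2 ∂cubeMeasure d = ‖g‖ ^ 2 := by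
  rw [← inner_self_eq_norm_sq (𝕜 := ℂ) g, ← integral_inner_fiber, ← integral_re]
  · exact integral_congr_ae (ae_of_all _ fun ω => (inner_self_eq_norm_sq (𝕜 := ℂ) _).symm)
  · exact integrable_inner_fiber g g

/-- Almost everywhere identities of Fourier transforms pass to fibers. -/
theorem fiber_eq_of_forall {d : ℕ} {g : L2 d} {v : Space d → lp (fun _ : Fin d → ℤ => ℂ) 2}
    (h : ∀ᵐ ω ∂cubeMeasure d, ∀ k : Fin d → ℤ, (𝓕 g : L2 d) (ω + latticeVec k) = v ω k) :
    ∀ᵐ ω ∂cubeMeasure d, fiber g ω = v ω := by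
  filter_upwards [h, fiber_apply g] with ω hω hg
  ext k
  rw [hg, hω]

theorem fiber_add {d : ℕ} (g h : L2 d) :
    ∀ᵐ ω ∂cubeMeasure d, fiber (g + h) ω = fiber g ω + fiber h ω := by
  refine fiber_eq_of_forall ?_
  have := ae_iff_ae_cube.1 (Lp.coeFn_add (𝓕 g : L2 d) (𝓕 h))
  filter_upwards [this, fiber_apply g, fiber_apply h] with ω hω hg hh k
  rw [FourierTransform.fourier_add, hω k, lp.coeFn_add, Pi.add_apply, Pi.add_apply, hg, hh]

theorem fiber_sub {d : ℕ} (g h : L2 d) :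
    ∀ᵐ ω ∂cubeMeasure d, fiber (g - h) ω = fiber g ω - fiber h ω := by
  filter_upwards [fiber_add (g - h) h] with ω hω
  rw [eq_sub_iff_add_eq, ← hω, sub_add_cancel]

theorem fiber_smul {d : ℕ} (c : ℂ) (g : L2 d) :
    ∀ᵐ ω ∂cubeMeasure d, fiber (c • g) ω = c • fiber g ω := by
  refine fiber_eq_of_forall ?_
  have := ae_iff_ae_cube.1 (Lp.coeFn_smul c (𝓕 g : L2 d))
  filter_upwards [this, fiber_apply g] with ω hω hg k
  rw [FourierTransform.fourier_smul, hω k, lp.coeFn_smul, Pi.smul_apply, Pi.smul_apply, hg]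

theorem fiber_zero {d : ℕ} : ∀ᵐ ω ∂cubeMeasure d, fiber (0 : L2 d) ω = 0 := by
  filter_upwards [fiber_sub (0 : L2 d) 0] with ω hω
  simpa using hω

/-! ### The Gramian -/

/-- The inner product is conjugate linear in its first slot, hence the reversed indices. This
reversal is what makes left eigenvectors the coefficients of the singular vectors. -/
theorem gramian_apply {d m : ℕ} (f : Fin m → L2 d) : ∀ᵐ ω ∂cubeMeasure d, ∀ i j,
    gramian f ω i j = ⟪fiber (f j) ω, fiber (f i) ω⟫_ℂ := by
  rw [ae_all_iff]; intro i
  rw [ae_all_iff]; intro j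
  filter_upwards [inner_fiber (f j) (f i)] with ω hω
  rw [hω]
  rfl

theorem measurable_gramian {d m : ℕ} (f : Fin m → L2 d) (i j : Fin m) :
    Measurable fun ω => gramian f ω i j := by
  refine Measurable.tsum fun k => ?_
  have h : ∀ i, Measurable fun ω : Space d => (𝓕 (f i) : L2 d) (ω + latticeVec k) := fun i =>
    (Lp.stronglyMeasurable _).measurable.comp (measurable_id.add_const _)
  exact (h i).mul (Complex.continuous_conj.measurable.comp (h j))

theorem gramian_add_latticeVec {d m : ℕ} (f : Fin m → L2 d) (ω : Space d) (k : Fin d → ℤ) :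
    gramian f (ω + latticeVec k) = gramian f ω := by
  ext i j
  simp only [gramian, Matrix.of_apply]
  rw [← (Equiv.addLeft k).tsum_eq (fun l : Fin d → ℤ =>
    (𝓕 (f i) : L2 d) (ω + latticeVec l) * conj ((𝓕 (f j) : L2 d) (ω + latticeVec l)))]
  simp [latticeVec_add, add_assoc]

theorem eigenvalue_congr {d m : ℕ} (f : Fin m → L2 d) {ω ω' : Space d}
    (h : gramian f ω = gramian f ω') (i : Fin m) : eigenvalue f ω i = eigenvalue f ω' i := by
  have key : ∀ (A B : Matrix (Fin m) (Fin m) ℂ) (hA : A.IsHermitian) (hB : B.IsHermitian),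
      A = B → hA.eigenvalues₀ = hB.eigenvalues₀ := by
    rintro A B hA hB rfl; rfl
  rw [eigenvalue, eigenvalue, key _ _ (gramian_isHermitian f ω) (gramian_isHermitian f ω') h]

/-! ### Characters and translations -/

/-- The projection `ℝᵈ → ℝᵈ / ℤᵈ`. -/
def toTorus {d : ℕ} (ω : Space d) : UnitAddTorus (Fin d) := fun i => (ω i : UnitAddCircle)

theorem continuous_toTorus {d : ℕ} : Continuous (toTorus (d := d)) :=
  continuous_pi fun i => (AddCircle.continuous_mk' 1).comp (by fun_prop)

/-- The character `ω ↦ exp(2πi k·ω)`. -/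
def character {d : ℕ} (k : Fin d → ℤ) (ω : Space d) : ℂ := UnitAddTorus.mFourier k (toTorus ω)

theorem character_eq {d : ℕ} (k : Fin d → ℤ) (ω : Space d) :
    character k ω = 𝐞 (⟪latticeVec k, ω⟫_ℝ) := by
  simp only [character, UnitAddTorus.mFourier, ContinuousMap.coe_mk, toTorus, fourier_coe_apply,
    ← Complex.exp_sum, Real.fourierChar_apply, PiLp.inner_apply, latticeVec_apply]
  congr 1
  simp only [RCLike.inner_apply, conj_trivial]
  push_cast
  rw [Finset.mul_sum, Finset.sum_mul]
  refine Finset.sum_congr rfl fun i _ => ?_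
  ring

theorem continuous_character {d : ℕ} (k : Fin d → ℤ) : Continuous (character k) :=
  (map_continuous _).comp continuous_toTorus

theorem norm_character {d : ℕ} (k : Fin d → ℤ) (ω : Space d) : ‖character k ω‖ = 1 := by
  rw [character_eq]; exact Circle.norm_coe _

theorem character_neg {d : ℕ} (k : Fin d → ℤ) (ω : Space d) :
    character (-k) ω = conj (character k ω) := UnitAddTorus.mFourier_neg

theorem character_add {d : ℕ} (k l : Fin d → ℤ) (ω : Space d) :
    character (k + l) ω = character k ω * character l ω := UnitAddTorus.mFourier_add

theorem character_add_latticeVec {d : ℕ} (k l : Fin d → ℤ) (ω : Space d) :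
    character k (ω + latticeVec l) = character k ω := by
  have : toTorus (ω + latticeVec l) = toTorus ω := by
    funext i
    simp [toTorus]
  rw [character, this, character]

theorem memLp_character_mul {d : ℕ} (k : Fin d → ℤ) (g : L2 d) :
    MemLp (fun ω => character (-k) ω * g ω) 2 volume := by
  refine (Lp.memLp g).of_le ((continuous_character _).aestronglyMeasurable.mul
    (Lp.aestronglyMeasurable g)) (ae_of_all _ fun ω => ?_)
  rw [norm_mul, norm_character, one_mul]

/-- Multiplication by the character `exp(-2πi k·ω)`. -/
def modulate {d : ℕ} (k : Fin d → ℤ) (g : L2 d) : L2 d := (memLp_character_mul k g).toLp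

theorem coeFn_modulate {d : ℕ} (k : Fin d → ℤ) (g : L2 d) :
    modulate k g =ᵐ[volume] fun ω => character (-k) ω * g ω := MemLp.coeFn_toLp _

theorem isometry_modulate {d : ℕ} (k : Fin d → ℤ) : Isometry (modulate k) := by
  refine Isometry.of_dist_eq fun g h => ?_
  rw [Lp.dist_def, Lp.dist_def]
  congr 1
  refine eLpNorm_congr_norm_ae ?_
  filter_upwards [coeFn_modulate k g, coeFn_modulate k h] with ω h1 h2
  simp only [Pi.sub_apply, h1, h2, ← mul_sub, norm_mul, norm_character, one_mul]

theorem fourier_schwartz_translate {d : ℕ} (k : Fin d → ℤ) (s : SchwartzMap (Space d) ℂ)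
    (ω : Space d) :
    𝓕 (s.compSubConstCLM ℂ (latticeVec k)) ω = character (-k) ω * 𝓕 s ω := by
  rw [SchwartzMap.fourier_coe, SchwartzMap.fourier_coe, Real.fourier_eq, Real.fourier_eq,
    character_eq, ← integral_const_mul]
  have h := integral_sub_right_eq_self (μ := (volume : Measure (Space d)))
    (fun v => 𝐞 (-⟪v + latticeVec k, ω⟫_ℝ) • s v) (latticeVec k)
  simp only [sub_add_cancel] at h
  refine h.trans (integral_congr_ae (ae_of_all _ fun x => ?_))
  simp only [latticeVec_neg, inner_add_left, neg_add, inner_neg_left, Circle.smul_def,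
    AddChar.map_add_eq_mul, Circle.coe_mul, smul_eq_mul]
  ring

/-- Both sides are continuous in `g` and agree on Schwartz functions, where the Fourier transform is
an integral; these are dense in $L^2$. -/
theorem fourier_translate_eq_modulate {d : ℕ} (k : Fin d → ℤ) (g : L2 d) :
    (𝓕 (translate k g) : L2 d) = modulate k (𝓕 g) := by
  have hd : DenseRange (SchwartzMap.toLpCLM ℂ (E := Space d) ℂ 2 volume) :=
    SchwartzMap.denseRange_toLpCLM ENNReal.ofNat_ne_top
  have h1 : Continuous fun g : L2 d => (𝓕 (translate k g) : L2 d) :=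
    (Lp.fourierTransformₗᵢ (Space d) ℂ).continuous.comp
      (Lp.isometry_compMeasurePreserving _).continuous
  have h2 : Continuous fun g : L2 d => modulate k (𝓕 g : L2 d) :=
    (isometry_modulate k).continuous.comp (Lp.fourierTransformₗᵢ (Space d) ℂ).continuous
  refine congrFun (hd.equalizer h1 h2 (funext fun s => ?_)) g
  have e : translate k (s.toLp 2 : L2 d) = (s.compSubConstCLM ℂ (latticeVec k)).toLp 2 := by
    refine Lp.ext ?_
    filter_upwards [Lp.coeFn_compMeasurePreserving (s.toLp 2 : L2 d)
        (measurePreserving_sub_right volume (latticeVec k)),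
      (measurePreserving_sub_right volume (latticeVec k)).quasiMeasurePreserving.ae
        (SchwartzMap.coeFn_toLp s 2 (volume : Measure (Space d))),
      SchwartzMap.coeFn_toLp (s.compSubConstCLM ℂ (latticeVec k)) 2 (volume : Measure (Space d))]
      with x h1 h2 h3
    rw [h3]
    exact h1.trans h2
  change (𝓕 (translate k (s.toLp 2 : L2 d)) : L2 d) = modulate k (𝓕 (s.toLp 2 : L2 d))
  rw [e, SchwartzMap.toLp_fourier_eq, SchwartzMap.toLp_fourier_eq]
  refine Lp.ext ?_
  filter_upwards [coeFn_modulate k ((𝓕 s).toLp 2 : L2 d),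
    SchwartzMap.coeFn_toLp (𝓕 s) 2 (volume : Measure (Space d)),
    SchwartzMap.coeFn_toLp (𝓕 (s.compSubConstCLM ℂ (latticeVec k))) 2
      (volume : Measure (Space d))] with ω h1 h2 h3
  rw [h1, h2, h3, fourier_schwartz_translate]

/-- The character is $\mathbb Z^d$-periodic, so it takes a single value along each fiber. -/
theorem fiber_translate {d : ℕ} (k : Fin d → ℤ) (g : L2 d) : ∀ᵐ ω ∂cubeMeasure d,
    fiber (translate k g) ω = character (-k) ω • fiber g ω := by
  refine fiber_eq_of_forall ?_
  have := ae_iff_ae_cube.1 (coeFn_modulate k (𝓕 g : L2 d))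
  filter_upwards [this, fiber_apply g] with ω hω hg l
  rw [fourier_translate_eq_modulate, hω, lp.coeFn_smul, Pi.smul_apply, hg,
    character_add_latticeVec, smul_eq_mul]

/-! ### Fourier coefficients -/

theorem integral_character {d : ℕ} (k : Fin d → ℤ) :
    ∫ ω, character k ω ∂cubeMeasure d = if k = 0 then 1 else 0 := by
  have h := (orthonormal_iff_ite.1 (UnitAddTorus.orthonormal_mFourier (d := Fin d))) 0 k
  simp only [ContinuousMap.inner_toLp, ← UnitAddTorus.mFourier_neg,
    ← UnitAddTorus.mFourier_add, neg_zero, add_zero] at h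
  rw [UnitAddTorus.integral_preimage _ 0] at h
  rw [show (if k = 0 then (1 : ℂ) else 0) = if 0 = k then 1 else 0 by simp [eq_comm], ← h]
  have := (PiLp.volume_preserving_ofLp (Fin d)).setIntegral_preimage_emb
    (MeasurableEquiv.toLp 2 (Fin d → ℝ)).symm.measurableEmbedding
    (fun x => UnitAddTorus.mFourier k fun i => (x i : UnitAddCircle))
    {x | ∀ i, x i ∈ Set.Ioc ((0 : Fin d → ℝ) i) ((0 : Fin d → ℝ) i + 1)}
  exact this

/-- The section of `toTorus` with values in the unit cube. -/
def ofTorus {d : ℕ} (x : UnitAddTorus (Fin d)) : Space d :=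
  WithLp.toLp 2 (UnitAddTorus.measurableEquivPiIoc (fun _ => (0 : ℝ)) x).1

theorem measurable_ofTorus {d : ℕ} : Measurable (ofTorus (d := d)) :=
  (MeasurableEquiv.toLp 2 (Fin d → ℝ)).measurable.comp
    (measurable_subtype_coe.comp (UnitAddTorus.measurableEquivPiIoc _).measurable)

theorem ofTorus_toTorus {d : ℕ} {ω : Space d} (hω : ω ∈ cube d) : ofTorus (toTorus ω) = ω := by
  have := (UnitAddTorus.measurableEquivPiIoc (fun _ : Fin d => (0 : ℝ))).apply_symm_apply
    ⟨ω.ofLp, hω⟩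
  rw [UnitAddTorus.coe_symm_measurableEquivPiIoc_apply] at this
  rw [ofTorus]
  change WithLp.toLp 2 ((UnitAddTorus.measurableEquivPiIoc (fun _ : Fin d => (0 : ℝ)))
    fun i => (ω i : UnitAddCircle)).1 = ω
  rw [this]

open BoundedContinuousFunction in
/-- Finite measures on the cube are determined by their Fourier coefficients. -/
theorem measure_ext_of_character {d : ℕ} {μ ν : Measure (Space d)} [IsFiniteMeasure μ]
    [IsFiniteMeasure ν] (hμ : ∀ᵐ ω ∂μ, ω ∈ cube d) (hν : ∀ᵐ ω ∂ν, ω ∈ cube d)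
    (h : ∀ k, ∫ ω, character k ω ∂μ = ∫ ω, character k ω ∂ν) : μ = ν := by
  have hm := (continuous_toTorus (d := d)).measurable
  -- On the compact torus the trigonometric polynomials form a star subalgebra separating points,
  -- and such an algebra determines a finite measure.
  have key : μ.map toTorus = ν.map toTorus := by
    let A : StarSubalgebra ℂ (UnitAddTorus (Fin d) →ᵇ ℂ) :=
      (UnitAddTorus.mFourierSubalgebra (Fin d)).comap (toContinuousMapStarₐ ℂ)
    refine ext_of_forall_mem_subalgebra_integral_eq_of_polish (A := A) ?_ ?_
    · intro x y hxy
      obtain ⟨_, ⟨g, hg, rfl⟩, hgxy⟩ := UnitAddTorus.mFourierSubalgebra_separatesPoints hxy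
      refine ⟨_, ⟨g, ⟨mkOfCompact g, ?_, ?_⟩, rfl⟩, hgxy⟩
      · exact hg
      · ext; rfl
    · intro g hg
      have hg' : (toContinuousMapStarₐ ℂ g) ∈
          Submodule.span ℂ (Set.range (UnitAddTorus.mFourier (d := Fin d))) := by
        rw [← UnitAddTorus.mFourierSubalgebra_coe]; exact hg
      have main : ∀ F ∈ Submodule.span ℂ (Set.range (UnitAddTorus.mFourier (d := Fin d))),
          ∫ x, F x ∂(μ.map toTorus) = ∫ x, F x ∂(ν.map toTorus) := by
        intro F hF
        induction hF using Submodule.span_induction with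
        | mem F hF =>
          obtain ⟨k, rfl⟩ := hF
          rw [integral_map hm.aemeasurable (map_continuous _).aestronglyMeasurable,
            integral_map hm.aemeasurable (map_continuous _).aestronglyMeasurable]
          exact h k
        | zero => simp
        | add F G _ _ hF hG =>
          have hi : ∀ (ρ : Measure (UnitAddTorus (Fin d))) [IsFiniteMeasure ρ]
              (F : C(UnitAddTorus (Fin d), ℂ)), Integrable F ρ := fun ρ _ F =>
            (mkOfCompact F).integrable ρ
          simp only [ContinuousMap.add_apply]
          rw [integral_add (hi _ F) (hi _ G), integral_add (hi _ F) (hi _ G), hF, hG]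
        | smul c F _ hF =>
          simp only [ContinuousMap.smul_apply]
          rw [integral_smul, integral_smul, hF]
      exact main _ hg'
  -- `ofTorus` inverts `toTorus` on the cube, so nothing is lost in passing to the torus.
  have back : ∀ ρ : Measure (Space d), (∀ᵐ ω ∂ρ, ω ∈ cube d) →
      (ρ.map toTorus).map ofTorus = ρ := by
    intro ρ hρ
    rw [Measure.map_map measurable_ofTorus hm]
    conv_rhs => rw [← Measure.map_id (μ := ρ)]
    exact Measure.map_congr (hρ.mono fun ω hω => ofTorus_toTorus hω)
  rw [← back μ hμ, ← back ν hν, key]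

/-- The positive and negative parts of `B` are densities of two finite measures with the same
Fourier coefficients. The measures agree, so the two parts agree almost everywhere; since at each
point one of them is zero, both are. -/
theorem ae_eq_zero_of_real_fourier_coeff {d : ℕ} {B : Space d → ℝ}
    (hB : Integrable B (cubeMeasure d))
    (h : ∀ k, ∫ ω, character k ω * B ω ∂cubeMeasure d = 0) : B =ᵐ[cubeMeasure d] 0 := by
  have hsupp : ∀ g : Space d → ℝ≥0∞, ∀ᵐ ω ∂(cubeMeasure d).withDensity g, ω ∈ cube d := fun g =>
    (withDensity_absolutelyContinuous _ g).ae_le (ae_restrict_mem (measurableSet_cube d))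
  have fin : ∀ C : Space d → ℝ, Integrable C (cubeMeasure d) →
      IsFiniteMeasure ((cubeMeasure d).withDensity fun ω => ENNReal.ofReal (C ω)) := fun C hC =>
    isFiniteMeasure_withDensity_ofReal hC.2
  have h1 := fin _ hB
  have h2 := fin _ hB.neg
  have int : ∀ C : Space d → ℝ, Integrable C (cubeMeasure d) → ∀ k,
      ∫ ω, character k ω ∂(cubeMeasure d).withDensity (fun ω => ENNReal.ofReal (C ω)) =
        ∫ ω, character k ω * (max (C ω) 0 : ℝ) ∂cubeMeasure d := by
    intro C hC k
    rw [integral_withDensity_eq_integral_toReal_smul₀ hC.1.aemeasurable.ennreal_ofReal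
      (ae_of_all _ fun _ => ENNReal.ofReal_lt_top)]
    refine integral_congr_ae (ae_of_all _ fun ω => ?_)
    simp only [ENNReal.toReal_ofReal', Complex.real_smul, mul_comm]
  have intg : ∀ C : Space d → ℝ, Integrable C (cubeMeasure d) → ∀ k,
      Integrable (fun ω => character k ω * (max (C ω) 0 : ℝ)) (cubeMeasure d) := by
    intro C hC k
    have := hC.pos_part.ofReal (𝕜 := ℂ)
    refine this.bdd_mul (c := 1) (continuous_character k).aestronglyMeasurable
      (ae_of_all _ fun ω => (norm_character k ω).le)
  have key := measure_ext_of_character (hsupp fun ω => ENNReal.ofReal (B ω))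
    (hsupp fun ω => ENNReal.ofReal ((-B) ω)) fun k => by
      rw [int _ hB, int _ hB.neg, ← sub_eq_zero, ← integral_sub (intg _ hB k) (intg _ hB.neg k),
        ← h k]
      refine integral_congr_ae (ae_of_all _ fun ω => ?_)
      simp only [← mul_sub, Pi.neg_apply, ← Complex.ofReal_sub]
      congr 2
      rcases le_total (B ω) 0 with hb | hb
      · rw [max_eq_right hb, max_eq_left (by linarith)]; ring
      · rw [max_eq_left hb, max_eq_right (by linarith)]; ring
  have hae := (withDensity_eq_iff hB.1.aemeasurable.ennreal_ofReal
    hB.neg.1.aemeasurable.ennreal_ofReal hB.lintegral_lt_top.ne).1 key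
  filter_upwards [hae] with ω hω
  rcases le_total (B ω) 0 with hb | hb
  · rw [ENNReal.ofReal_of_nonpos hb, eq_comm, ENNReal.ofReal_eq_zero, Pi.neg_apply] at hω
    simp only [Pi.zero_apply]; linarith
  · have h0 : ENNReal.ofReal ((-B) ω) = 0 := ENNReal.ofReal_of_nonpos (by simpa using hb)
    rw [h0, ENNReal.ofReal_eq_zero] at hω
    simp only [Pi.zero_apply]; linarith

/-- An integrable function on the cube all of whose Fourier coefficients vanish is zero. -/
theorem ae_eq_zero_of_fourier_coeff {d : ℕ} {B : Space d → ℂ}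
    (hB : Integrable B (cubeMeasure d))
    (h : ∀ k, ∫ ω, character k ω * B ω ∂cubeMeasure d = 0) : B =ᵐ[cubeMeasure d] 0 := by
  have hi : ∀ C : Space d → ℂ, Integrable C (cubeMeasure d) → ∀ k,
      Integrable (fun ω => character k ω * C ω) (cubeMeasure d) := fun C hC k =>
    hC.bdd_mul (c := 1) (continuous_character k).aestronglyMeasurable
      (ae_of_all _ fun ω => (norm_character k ω).le)
  have hBc : Integrable (fun ω => conj (B ω)) (cubeMeasure d) :=
    Complex.conjCLE.toContinuousLinearMap.integrable_comp hB
  -- The coefficients of the conjugate are the conjugates of the coefficients at `-k`, so those of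
  -- the real and imaginary parts vanish as well.
  have hc : ∀ k, ∫ ω, character k ω * conj (B ω) ∂cubeMeasure d = 0 := by
    intro k
    have := congrArg conj (h (-k))
    rw [← integral_conj, map_zero] at this
    rw [← this]
    refine integral_congr_ae (ae_of_all _ fun ω => ?_)
    simp [character_neg]
  have hre := ae_eq_zero_of_real_fourier_coeff hB.re fun k => by
    have e : ∀ ω, character k ω * ((RCLike.re (B ω) : ℝ) : ℂ) =
        (1 / 2 : ℂ) * (character k ω * B ω + character k ω * conj (B ω)) := by
      intro ω
      have := Complex.add_conj (B ω)
      rw [← mul_add, this]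
      push_cast
      simp
      ring
    simp only [e]
    rw [integral_const_mul, integral_add (hi _ hB k) (hi _ hBc k), h, hc]
    simp
  have him := ae_eq_zero_of_real_fourier_coeff hB.im fun k => by
    have e : ∀ ω, character k ω * ((RCLike.im (B ω) : ℝ) : ℂ) =
        (1 / (2 * Complex.I) : ℂ) * (character k ω * B ω - character k ω * conj (B ω)) := by
      intro ω
      have := Complex.sub_conj (B ω)
      rw [← mul_sub, this]
      push_cast
      field_simp
      simp
    simp only [e]
    rw [integral_const_mul, integral_sub (hi _ hB k) (hi _ hBc k), h, hc]
    simp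
  filter_upwards [hre, him] with ω h1 h2
  exact Complex.ext h1 h2

theorem inner_translate_eq {d : ℕ} (k : Fin d → ℤ) (g h : L2 d) :
    ⟪translate k g, h⟫_ℂ =
      ∫ ω, character k ω * ⟪fiber g ω, fiber h ω⟫_ℂ ∂cubeMeasure d := by
  rw [← integral_inner_fiber]
  refine integral_congr_ae ?_
  filter_upwards [fiber_translate k g] with ω hω
  rw [hω, inner_smul_left, character_neg, Complex.conj_conj]

/-- `h` is orthogonal to all translates of `g` if and only if their fibers are orthogonal. -/
theorem forall_inner_translate_eq_zero_iff {d : ℕ} (g h : L2 d) :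
    (∀ k, ⟪translate k g, h⟫_ℂ = 0) ↔
      ∀ᵐ ω ∂cubeMeasure d, ⟪fiber g ω, fiber h ω⟫_ℂ = 0 := by
  constructor
  · intro H
    exact ae_eq_zero_of_fourier_coeff (integrable_inner_fiber g h) fun k => by
      rw [← inner_translate_eq, H]
  · intro H k
    rw [inner_translate_eq, integral_eq_zero_of_ae]
    filter_upwards [H] with ω hω
    rw [hω]; simp

/-! ### Sorted eigenvalues of Hermitian matrices -/

/-- The eigenvalues of a Hermitian matrix in decreasing order, indexed by `Fin m`. -/
def sortedEigenvalue {m : ℕ} {A : Matrix (Fin m) (Fin m) ℂ} (hA : A.IsHermitian) (i : Fin m) : ℝ :=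
  hA.eigenvalues₀ (Fin.cast (Fintype.card_fin m).symm i)

section Sorted

variable {m : ℕ} {A : Matrix (Fin m) (Fin m) ℂ} (hA : A.IsHermitian)

theorem sortedEigenvalue_antitone : Antitone (sortedEigenvalue hA) := fun _ _ hij =>
  hA.eigenvalues₀_antitone hij

theorem exists_eigenbasis : ∃ b : OrthonormalBasis (Fin m) ℂ (EuclideanSpace ℂ (Fin m)),
    ∀ a, A *ᵥ (b a).ofLp = (sortedEigenvalue hA a : ℂ) • (b a).ofLp := by
  -- This is the equivalence by which `eigenvalues` is obtained from the sorted `eigenvalues₀`.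
  let σ : Fin m ≃ Fin m := (finCongr (Fintype.card_fin m).symm).trans
    (Fintype.equivOfCardEq (Fintype.card_fin _))
  refine ⟨hA.eigenvectorBasis.reindex σ.symm, fun a => ?_⟩
  rw [OrthonormalBasis.reindex_apply, Equiv.symm_symm]
  have h := hA.mulVec_eigenvectorBasis (σ a)
  have e : hA.eigenvalues (σ a) = sortedEigenvalue hA a := by
    simp [Matrix.IsHermitian.eigenvalues, sortedEigenvalue, σ]
  rw [e] at h
  exact h

/-- A matrix and its transpose have the same characteristic polynomial, whose sorted roots are the
eigenvalues. Needed because left eigenvectors are eigenvectors of the transpose. -/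
theorem sortedEigenvalue_transpose (hT : Aᵀ.IsHermitian) :
    sortedEigenvalue hT = sortedEigenvalue hA := by
  have h : hT.eigenvalues₀ = hA.eigenvalues₀ := by
    rw [← List.ofFn_inj, ← Matrix.IsHermitian.sort_roots_charpoly_eq_eigenvalues₀,
      ← Matrix.IsHermitian.sort_roots_charpoly_eq_eigenvalues₀, Matrix.charpoly_transpose]
  funext i
  rw [sortedEigenvalue, sortedEigenvalue, h]

theorem exists_left_eigenbasis : ∃ b : OrthonormalBasis (Fin m) ℂ (EuclideanSpace ℂ (Fin m)),
    ∀ a, (b a).ofLp ᵥ* A = (sortedEigenvalue hA a : ℂ) • (b a).ofLp := by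
  obtain ⟨b, hb⟩ := exists_eigenbasis hA.transpose
  refine ⟨b, fun a => ?_⟩
  rw [← Matrix.mulVec_transpose, hb, sortedEigenvalue_transpose hA]

/-- If the smallest of the first `n` eigenvalues is nonzero, the rank is at least `n`. -/
theorem le_rank_of_sortedEigenvalue_pos {n : ℕ} (hn : n ≤ m)
    (h : ∀ a : Fin n, sortedEigenvalue hA (Fin.castLE hn a) ≠ 0) : n ≤ A.rank := by
  rw [hA.rank_eq_card_non_zero_eigs]
  let σ : Fin m ≃ Fin m := (finCongr (Fintype.card_fin m).symm).trans
    (Fintype.equivOfCardEq (Fintype.card_fin _))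
  have e : ∀ a, hA.eigenvalues (σ a) = sortedEigenvalue hA a := fun a => by
    simp [Matrix.IsHermitian.eigenvalues, sortedEigenvalue, σ]
  have := Fintype.card_le_of_injective
    (fun a : Fin n => (⟨σ (Fin.castLE hn a), by rw [e]; exact h a⟩ :
      {i // hA.eigenvalues i ≠ 0})) fun a b hab => by
        simpa using hab
  simpa using this

end Sorted

theorem inner_eq_dotProduct {m : ℕ} (x y : EuclideanSpace ℂ (Fin m)) :
    ⟪x, y⟫_ℂ = y.ofLp ⬝ᵥ star x.ofLp := EuclideanSpace.inner_eq_star_dotProduct x y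

theorem ofLp_eq_sum_repr {m : ℕ} (b : OrthonormalBasis (Fin m) ℂ (EuclideanSpace ℂ (Fin m)))
    (x : EuclideanSpace ℂ (Fin m)) : x.ofLp = ∑ a, ⟪b a, x⟫_ℂ • (b a).ofLp := by
  conv_lhs => rw [← b.sum_repr' x]
  simp

theorem mulVec_eq_sum {m : ℕ} {A : Matrix (Fin m) (Fin m) ℂ}
    (b : OrthonormalBasis (Fin m) ℂ (EuclideanSpace ℂ (Fin m))) {l : Fin m → ℝ}
    (hb : ∀ a, A *ᵥ (b a).ofLp = (l a : ℂ) • (b a).ofLp) (x : EuclideanSpace ℂ (Fin m)) :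
    A *ᵥ x.ofLp = ∑ a, (⟪b a, x⟫_ℂ * l a) • (b a).ofLp := by
  rw [ofLp_eq_sum_repr b x, Matrix.mulVec_sum]
  refine Finset.sum_congr rfl fun a _ => ?_
  rw [Matrix.mulVec_smul, hb, smul_smul]

theorem inner_mulVec_eq_sum {m : ℕ} {A : Matrix (Fin m) (Fin m) ℂ}
    (b : OrthonormalBasis (Fin m) ℂ (EuclideanSpace ℂ (Fin m))) {l : Fin m → ℝ}
    (hb : ∀ a, A *ᵥ (b a).ofLp = (l a : ℂ) • (b a).ofLp) (x : EuclideanSpace ℂ (Fin m)) :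
    ⟪x, WithLp.toLp 2 (A *ᵥ x.ofLp)⟫_ℂ = ((∑ a, l a * ‖⟪b a, x⟫_ℂ‖ ^ 2 : ℝ) : ℂ) := by
  rw [mulVec_eq_sum b hb x]
  have : (WithLp.toLp 2 (∑ a, (⟪b a, x⟫_ℂ * l a) • (b a).ofLp) : EuclideanSpace ℂ (Fin m)) =
      ∑ a, (⟪b a, x⟫_ℂ * l a) • b a := by
    ext i; simp
  rw [this, inner_sum]
  push_cast
  refine Finset.sum_congr rfl fun a _ => ?_
  rw [inner_smul_right, ← inner_conj_symm x (b a), ← Complex.mul_conj']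
  ring

/-- There is a nonzero vector orthogonal to all but one of `m` given vectors of `ℂᵐ`. -/
theorem exists_ne_zero_orthogonal {m : ℕ} (a : Fin m) (c : Fin m → EuclideanSpace ℂ (Fin m)) :
    ∃ x : EuclideanSpace ℂ (Fin m), x ≠ 0 ∧ ∀ i, i ≠ a → ⟪c i, x⟫_ℂ = 0 := by
  let T : EuclideanSpace ℂ (Fin m) →ₗ[ℂ] ({i // i ≠ a} → ℂ) :=
    LinearMap.pi fun i => (innerSL ℂ (c i)).toLinearMap
  have hlt : Module.finrank ℂ ({i // i ≠ a} → ℂ) <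
      Module.finrank ℂ (EuclideanSpace ℂ (Fin m)) := by
    rw [Module.finrank_fintype_fun_eq_card, finrank_euclideanSpace]
    exact Fintype.card_subtype_lt (x := a) (by simp)
  obtain ⟨x, hx, hx0⟩ := (Submodule.ne_bot_iff _).1
    (LinearMap.ker_ne_bot_of_finrank_lt (f := T) hlt)
  exact ⟨x, hx0, fun i hi => congrFun hx ⟨i, hi⟩⟩

/-- Weyl's monotonicity of sorted eigenvalues. -/
theorem sortedEigenvalue_le_add {m : ℕ} {A B : Matrix (Fin m) (Fin m) ℂ} (hA : A.IsHermitian)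
    (hB : B.IsHermitian) {ε : ℝ} (h : ∀ x : EuclideanSpace ℂ (Fin m),
      (⟪x, WithLp.toLp 2 (A *ᵥ x.ofLp)⟫_ℂ).re ≤
        (⟪x, WithLp.toLp 2 (B *ᵥ x.ofLp)⟫_ℂ).re + ε * ‖x‖ ^ 2) (a : Fin m) :
    sortedEigenvalue hA a ≤ sortedEigenvalue hB a + ε := by
  obtain ⟨bA, hbA⟩ := exists_eigenbasis hA
  obtain ⟨bB, hbB⟩ := exists_eigenbasis hB
  -- Courant–Fischer: the $m-1$ conditions leave a vector on which the form of `A` is at least its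
  -- `a`-th eigenvalue and the form of `B` at most its `a`-th eigenvalue.
  obtain ⟨x, hx0, hx⟩ := exists_ne_zero_orthogonal a fun i => if a < i then bA i else bB i
  have hxA : ∀ i, a < i → ⟪bA i, x⟫_ℂ = 0 := fun i hi => by
    simpa [hi] using hx i hi.ne'
  have hxB : ∀ i, i < a → ⟪bB i, x⟫_ℂ = 0 := fun i hi => by
    simpa [hi.le.not_gt] using hx i hi.ne
  have h1 := h x
  rw [inner_mulVec_eq_sum bA hbA, inner_mulVec_eq_sum bB hbB, Complex.ofReal_re,
    Complex.ofReal_re] at h1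
  have h2 : sortedEigenvalue hA a * ‖x‖ ^ 2 ≤ ∑ i, sortedEigenvalue hA i * ‖⟪bA i, x⟫_ℂ‖ ^ 2 := by
    rw [← bA.sum_sq_norm_inner_right x, Finset.mul_sum]
    refine Finset.sum_le_sum fun i _ => ?_
    rcases lt_or_ge a i with hi | hi
    · simp [hxA i hi]
    · gcongr
      exact sortedEigenvalue_antitone hA hi
  have h3 : ∑ i, sortedEigenvalue hB i * ‖⟪bB i, x⟫_ℂ‖ ^ 2 ≤ sortedEigenvalue hB a * ‖x‖ ^ 2 := by
    rw [← bB.sum_sq_norm_inner_right x, Finset.mul_sum]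
    refine Finset.sum_le_sum fun i _ => ?_
    rcases lt_or_ge i a with hi | hi
    · simp [hxB i hi]
    · gcongr
      exact sortedEigenvalue_antitone hB hi
  have hpos : 0 < ‖x‖ ^ 2 := by positivity
  nlinarith

/-! ### Low-rank approximation in a Hilbert space -/

section EckartYoung

variable {H : Type*} [NormedAddCommGroup H] [InnerProductSpace ℂ H]

instance hasOrthogonalProjection_span_range {ι : Type*} [Finite ι] (e : ι → H) :
    (Submodule.span ℂ (Set.range e)).HasOrthogonalProjection :=
  haveI : FiniteDimensional ℂ (Submodule.span ℂ (Set.range e)) :=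
    FiniteDimensional.span_of_finite ℂ (Set.finite_range e)
  inferInstance

theorem norm_starProjection_sq_eq_sum {ι : Type*} [Fintype ι] {e : ι → H} (he : Orthonormal ℂ e)
    {K : Submodule ℂ H} [K.HasOrthogonalProjection] (hK : Submodule.span ℂ (Set.range e) = K)
    (w : H) : ‖K.starProjection w‖ ^ 2 = ∑ i, ‖⟪e i, w⟫_ℂ‖ ^ 2 := by
  classical
  have hp : K.starProjection w = ∑ i, ⟪e i, w⟫_ℂ • e i := by
    refine Submodule.eq_starProjection_of_mem_of_inner_eq_zero ?_ fun z hz => ?_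
    · rw [← hK]
      exact Submodule.sum_mem _ fun i _ =>
        Submodule.smul_mem _ _ (Submodule.subset_span ⟨i, rfl⟩)
    · rw [← hK] at hz
      induction hz using Submodule.span_induction with
      | mem z hz =>
        obtain ⟨i, rfl⟩ := hz
        rw [inner_sub_left, sum_inner, Finset.sum_eq_single i]
        · rw [inner_smul_left, inner_conj_symm, inner_self_eq_norm_sq_to_K, he.1 i]
          simp
        · intro j _ hj
          rw [inner_smul_left, he.2 hj, mul_zero]
        · simp
      | zero => simp
      | add x y _ _ hx hy => rw [inner_add_right, hx, hy, add_zero]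
      | smul c x _ hx => rw [inner_smul_right, hx, mul_zero]
  rw [← RCLike.ofReal_inj (K := ℂ), RCLike.ofReal_pow, ← inner_self_eq_norm_sq_to_K, hp,
    he.inner_sum]
  push_cast
  exact Finset.sum_congr rfl fun i _ => RCLike.conj_mul _

/-- The weighted sums `∑ λᵢ tᵢ` with `0 ≤ tᵢ ≤ 1`, `∑ tᵢ ≤ n` are maximal exactly for the
indicator of the first `n` indices. -/
theorem sum_mul_le_sum_castLE {m n : ℕ} (hn : 1 ≤ n) (hnm : n < m) {l t : Fin m → ℝ}
    (hl : Antitone l) (hl0 : ∀ a, 0 ≤ l a)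
    (hgap : l ⟨n, hnm⟩ < l ⟨n - 1, (Nat.sub_le n 1).trans_lt hnm⟩)
    (ht0 : ∀ a, 0 ≤ t a) (ht1 : ∀ a, t a ≤ 1) (ht : ∑ a, t a ≤ n) :
    ∑ a, l a * t a ≤ ∑ a : Fin n, l (Fin.castLE hnm.le a) ∧
      (∑ a, l a * t a = ∑ a : Fin n, l (Fin.castLE hnm.le a) →
        ∀ a : Fin n, t (Fin.castLE hnm.le a) = 1) := by
  set p : ℝ := l ⟨n - 1, (Nat.sub_le n 1).trans_lt hnm⟩ with hp
  have hp0 : 0 < p := lt_of_le_of_lt (hl0 _) hgap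
  let χ : Fin m → ℝ := fun a => if (a : ℕ) < n then 1 else 0
  have hsum : ∀ g : Fin m → ℝ, ∑ a, g a * χ a = ∑ a : Fin n, g (Fin.castLE hnm.le a) := by
    intro g
    simp only [χ, mul_ite, mul_one, mul_zero, ← Finset.sum_filter]
    refine (Finset.sum_bij (fun a _ => Fin.castLE hnm.le a) ?_ ?_ ?_ ?_).symm
    · intro a _; simp
    · intro a _ b _ hab; simpa using hab
    · intro b hb
      exact ⟨⟨b, by simpa using hb⟩, by simp, by ext; simp⟩
    · intro a _; rfl
  have hχ : ∑ a, χ a = n := by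
    have := hsum fun _ => 1
    simpa using this
  have hterm : ∀ a, 0 ≤ (l a - p) * (χ a - t a) := by
    intro a
    by_cases ha : (a : ℕ) < n
    · have : p ≤ l a := hl (by rw [Fin.le_def]; simp; omega)
      have h1 := ht1 a
      simp only [χ, ha, if_true]
      exact mul_nonneg (by linarith) (by linarith)
    · have : l a ≤ p := hl (by rw [Fin.le_def]; simp; omega)
      have h1 := ht0 a
      simp only [χ, ha, if_false]
      exact mul_nonneg_of_nonpos_of_nonpos (by linarith) (by linarith)
  -- Subtracting the threshold `p` makes every term nonnegative: `l a - p` changes sign exactly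
  -- where `χ a - t a` does. Equality must then hold term by term.
  have hid : ∑ a : Fin n, l (Fin.castLE hnm.le a) - ∑ a, l a * t a =
      ∑ a, (l a - p) * (χ a - t a) + p * (n - ∑ a, t a) := by
    rw [← hsum l, ← hχ, ← Finset.sum_sub_distrib, ← Finset.sum_sub_distrib, Finset.mul_sum,
      ← Finset.sum_add_distrib]
    exact Finset.sum_congr rfl fun a _ => by ring
  have hs0 : 0 ≤ ∑ a, (l a - p) * (χ a - t a) := Finset.sum_nonneg fun a _ => hterm a
  have hr0 : 0 ≤ p * (n - ∑ a, t a) := mul_nonneg hp0.le (by linarith)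
  refine ⟨by linarith, fun heq => ?_⟩
  have hs : ∑ a, (l a - p) * (χ a - t a) = 0 := by linarith
  have hr : p * (n - ∑ a, t a) = 0 := by linarith
  have htn : ∑ a, t a = n := by
    rcases mul_eq_zero.1 hr with h | h <;> linarith
  have hz := (Finset.sum_eq_zero_iff_of_nonneg fun a _ => hterm a).1 hs
  -- Here the gap enters: beyond the first `n` indices `l a < p` strictly, so a vanishing term
  -- forces `t a = 0`.
  have hbig : ∀ a : Fin m, ¬ (a : ℕ) < n → t a = 0 := by
    intro a ha
    have h1 := hz a (Finset.mem_univ a)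
    have h2 : l a ≤ l ⟨n, hnm⟩ := hl (by rw [Fin.le_def]; simp; omega)
    simp only [χ, ha, if_false] at h1
    rcases mul_eq_zero.1 h1 with h | h <;> linarith
  have hd : ∑ a, (χ a - t a) = 0 := by rw [Finset.sum_sub_distrib, hχ, htn, sub_self]
  have hd0 : ∀ a ∈ Finset.univ, 0 ≤ χ a - t a := by
    intro a _
    by_cases ha : (a : ℕ) < n
    · simp only [χ, ha, if_true]; linarith [ht1 a]
    · simp [χ, ha, hbig a ha]
  intro a
  have := (Finset.sum_eq_zero_iff_of_nonneg hd0).1 hd (Fin.castLE hnm.le a) (Finset.mem_univ _)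
  simp only [χ, Fin.val_castLE, a.2, if_true] at this
  linarith

variable {m : ℕ} (v : Fin m → H)

/-- The linear combination of the vectors `v` with coefficients `y`. -/
def combination (y : EuclideanSpace ℂ (Fin m)) : H := ∑ i, y i • v i

variable {v} {A : Matrix (Fin m) (Fin m) ℂ} (hv : ∀ i j, A i j = ⟪v j, v i⟫_ℂ)

include hv

theorem inner_combination_right (i : Fin m) (y : EuclideanSpace ℂ (Fin m)) :
    ⟪v i, combination v y⟫_ℂ = (y.ofLp ᵥ* A) i := by
  rw [combination, inner_sum, Matrix.vecMul, dotProduct]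
  exact Finset.sum_congr rfl fun j _ => by rw [inner_smul_right, hv]

/-- The singular value decomposition in disguise: orthogonal left eigenvectors have orthogonal
combinations, and a unit one has a combination of squared norm equal to its eigenvalue. -/
theorem inner_combination_of_left_eigenvector {l : ℝ} {y : EuclideanSpace ℂ (Fin m)}
    (hy : y.ofLp ᵥ* A = (l : ℂ) • y.ofLp) (x : EuclideanSpace ℂ (Fin m)) :
    ⟪combination v x, combination v y⟫_ℂ = l * ⟪x, y⟫_ℂ := by
  conv_lhs => rw [combination, sum_inner]
  rw [PiLp.inner_apply, Finset.mul_sum]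
  refine Finset.sum_congr rfl fun i _ => ?_
  rw [inner_smul_left, inner_combination_right hv, hy, Pi.smul_apply, smul_eq_mul]
  simp only [RCLike.inner_apply]
  ring

theorem orthonormal_normalized_combination {ι : Type*} {l : ι → ℝ} (hl : ∀ a, 0 < l a)
    {y : ι → EuclideanSpace ℂ (Fin m)} (hy : ∀ a, (y a).ofLp ᵥ* A = (l a : ℂ) • (y a).ofLp)
    (hyo : Orthonormal ℂ y) :
    Orthonormal ℂ fun a => ((l a ^ (-(1 / 2) : ℝ) : ℝ) : ℂ) • combination v (y a) := by
  classical
  rw [orthonormal_iff_ite]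
  intro a b
  rw [inner_smul_left, inner_smul_right, inner_combination_of_left_eigenvector hv (hy b),
    orthonormal_iff_ite.1 hyo a b]
  split_ifs with h
  · subst h
    have h2 : l a ^ (-(1 / 2) : ℝ) * l a ^ (-(1 / 2) : ℝ) * l a = 1 := by
      rw [← Real.rpow_add (hl a)]
      norm_num
      rw [Real.rpow_neg_one, inv_mul_cancel₀ (hl a).ne']
    rw [Complex.conj_ofReal, mul_one, ← mul_assoc]
    exact_mod_cast h2
  · simp

/-- The component of `v i` along the `a`-th singular vector has squared modulus $l_a|y_{a,i}|^2$,
and each `y a` is a unit vector. -/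
theorem sum_norm_starProjection_eq_of_left_eigenvectors {n : ℕ} {l : Fin n → ℝ}
    (hl : ∀ a, 0 < l a) {y : Fin n → EuclideanSpace ℂ (Fin m)}
    (hy : ∀ a, (y a).ofLp ᵥ* A = (l a : ℂ) • (y a).ofLp) (hyo : Orthonormal ℂ y)
    {K : Submodule ℂ H} [K.HasOrthogonalProjection]
    (hK : Submodule.span ℂ (Set.range fun a =>
      ((l a ^ (-(1 / 2) : ℝ) : ℝ) : ℂ) • combination v (y a)) = K) :
    ∑ i, ‖K.starProjection (v i)‖ ^ 2 = ∑ a, l a := by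
  simp only [norm_starProjection_sq_eq_sum (orthonormal_normalized_combination hv hl hy hyo) hK]
  rw [Finset.sum_comm]
  refine Finset.sum_congr rfl fun a _ => ?_
  have h1 : ∀ i, ‖⟪((l a ^ (-(1 / 2) : ℝ) : ℝ) : ℂ) • combination v (y a), v i⟫_ℂ‖ ^ 2 =
      l a * ‖y a i‖ ^ 2 := by
    intro i
    rw [norm_inner_symm, inner_smul_right, inner_combination_right hv, hy, Pi.smul_apply,
      smul_eq_mul, norm_mul, norm_mul, Complex.norm_real, Complex.norm_real, Real.norm_eq_abs,
      Real.norm_eq_abs, abs_of_pos (hl a), abs_of_pos (Real.rpow_pos_of_pos (hl a) _), mul_pow,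
      mul_pow, ← mul_assoc]
    congr 1
    rw [← Real.rpow_natCast, ← Real.rpow_mul (hl a).le]
    norm_num
    rw [Real.rpow_neg_one, pow_two, inv_mul_cancel_left₀ (hl a).ne']
  simp only [h1, ← Finset.mul_sum]
  have h2 := EuclideanSpace.norm_sq_eq (y a)
  rw [hyo.1 a] at h2
  rw [← h2]; simp

theorem sortedEigenvalue_nonneg_of_gram (hA : A.IsHermitian) (a : Fin m) :
    0 ≤ sortedEigenvalue hA a := by
  obtain ⟨z, hz⟩ := exists_left_eigenbasis hA
  have h := inner_combination_of_left_eigenvector hv (hz a) (z a)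
  rw [inner_self_eq_norm_sq_to_K, inner_self_eq_norm_sq_to_K, z.orthonormal.1 a] at h
  have h' : ((‖combination v (z a)‖ ^ 2 : ℝ) : ℂ) = (sortedEigenvalue hA a : ℂ) := by
    simpa using h
  rw [← Complex.ofReal_inj.1 h']
  positivity

/-- Eckart–Young with uniqueness: if the `n`-th and `n+1`-st eigenvalues of the Gram matrix
differ, there is exactly one candidate for the best approximating subspace of dimension `≤ n`. -/
theorem exists_unique_best_subspace {n : ℕ} (hn : 1 ≤ n) (hnm : n < m) (hA : A.IsHermitian)
    (hgap : sortedEigenvalue hA ⟨n, hnm⟩ <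
      sortedEigenvalue hA ⟨n - 1, (Nat.sub_le n 1).trans_lt hnm⟩) :
    ∃ K₀ : Submodule ℂ H, ∀ (K : Submodule ℂ H) [FiniteDimensional ℂ K]
      [K.HasOrthogonalProjection], Module.finrank ℂ K ≤ n →
      ∑ i, ‖K.starProjection (v i)‖ ^ 2 ≤
          ∑ a : Fin n, sortedEigenvalue hA (Fin.castLE hnm.le a) ∧
        (∑ i, ‖K.starProjection (v i)‖ ^ 2 =
          ∑ a : Fin n, sortedEigenvalue hA (Fin.castLE hnm.le a) → K = K₀) := by
  classical
  obtain ⟨z, hz⟩ := exists_left_eigenbasis hA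
  set l := sortedEigenvalue hA with hl
  have hl0 : ∀ a, 0 ≤ l a := sortedEigenvalue_nonneg_of_gram hv hA
  have hanti : Antitone l := sortedEigenvalue_antitone hA
  let S : Type := {a // l a ≠ 0}
  have hlS : ∀ a : S, 0 < l a.1 := fun a => lt_of_le_of_ne (hl0 _) a.2.symm
  let e : Fin m → H := fun a => ((l a ^ (-(1 / 2) : ℝ) : ℝ) : ℂ) • combination v (z a)
  have heS : Orthonormal ℂ fun a : S => e a.1 :=
    orthonormal_normalized_combination hv hlS (fun a => hz a.1)
      (z.orthonormal.comp _ Subtype.val_injective)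
  have hfirst : ∀ a : Fin n, l (Fin.castLE hnm.le a) ≠ 0 := fun a => by
    have h1 : l ⟨n - 1, (Nat.sub_le n 1).trans_lt hnm⟩ ≤ l (Fin.castLE hnm.le a) :=
      hanti (by rw [Fin.le_def]; simp; omega)
    exact (lt_of_lt_of_le (lt_of_le_of_lt (hl0 _) hgap) h1).ne'
  have heF : Orthonormal ℂ fun a : Fin n => e (Fin.castLE hnm.le a) :=
    heS.comp (fun a : Fin n => (⟨Fin.castLE hnm.le a, hfirst a⟩ : S))
      fun a b hab => Fin.castLE_injective hnm.le (congrArg Subtype.val hab)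
  refine ⟨Submodule.span ℂ (Set.range fun a : Fin n => e (Fin.castLE hnm.le a)), ?_⟩
  intro K _ _ hK
  -- The weight with which `K` captures the `a`-th singular vector. Where the eigenvalue is zero the
  -- combination itself vanishes, so setting the weight to `0` loses nothing.
  let t : Fin m → ℝ := fun a => if l a = 0 then 0 else ‖K.starProjection (e a)‖ ^ 2
  let b := stdOrthonormalBasis ℂ K
  have hbo : Orthonormal ℂ fun r => (b r : H) := b.orthonormal.comp_linearIsometry K.subtypeₗᵢ
  have hbK : Submodule.span ℂ (Set.range fun r => (b r : H)) = K := by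
    have h1 := b.toBasis.span_eq
    have h2 := congrArg (Submodule.map K.subtype) h1
    rw [Submodule.map_span, ← Set.range_comp, Submodule.map_top, Submodule.range_subtype] at h2
    simpa [Function.comp_def] using h2
  have hP := norm_starProjection_sq_eq_sum hbo hbK
  have hu : ∀ a, ‖K.starProjection (combination v (z a))‖ ^ 2 = l a * t a := by
    intro a
    by_cases ha : l a = 0
    · have h := inner_combination_of_left_eigenvector hv (hz a) (z a)
      rw [ha, Complex.ofReal_zero, zero_mul, inner_self_eq_zero] at h
      simp [h, ha]
    · have hpos : 0 < l a := lt_of_le_of_ne (hl0 _) (Ne.symm ha)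
      simp only [t, ha, if_false, e, map_smul, norm_smul, Complex.norm_real, Real.norm_eq_abs,
        abs_of_pos (Real.rpow_pos_of_pos hpos _), mul_pow]
      rw [← mul_assoc, ← Real.rpow_natCast (l a ^ _), ← Real.rpow_mul hpos.le]
      norm_num
      rw [Real.rpow_neg_one, mul_inv_cancel₀ ha, one_mul]
  -- A unitary change of coefficients preserves the captured energy: for each basis vector of `K`
  -- this is Parseval for `z`.
  have hsum : ∑ i, ‖K.starProjection (v i)‖ ^ 2 = ∑ a, l a * t a := by
    simp only [← hu, hP]
    rw [Finset.sum_comm, Finset.sum_comm (γ := Fin m)]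
    refine Finset.sum_congr rfl fun r _ => ?_
    let c : EuclideanSpace ℂ (Fin m) := WithLp.toLp 2 fun i => ⟪v i, (b r : H)⟫_ℂ
    have h1 : ∀ a, ⟪(b r : H), combination v (z a)⟫_ℂ = ⟪c, z a⟫_ℂ := by
      intro a
      rw [combination, inner_sum, PiLp.inner_apply]
      refine Finset.sum_congr rfl fun i _ => ?_
      simp only [c, inner_smul_right, RCLike.inner_apply, inner_conj_symm]
    simp only [h1]
    rw [z.sum_sq_norm_inner_left, EuclideanSpace.norm_sq_eq]
    exact Finset.sum_congr rfl fun i _ => by rw [norm_inner_symm]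
  have hnorm : ∀ a, l a ≠ 0 → ‖e a‖ = 1 := fun a ha => heS.1 ⟨a, ha⟩
  have ht0 : ∀ a, 0 ≤ t a := fun a => by
    simp only [t]; split_ifs <;> positivity
  have ht1 : ∀ a, t a ≤ 1 := fun a => by
    simp only [t]
    split_ifs with ha
    · exact zero_le_one
    · have := K.norm_starProjection_apply_le (e a)
      rw [hnorm a ha] at this
      exact pow_le_one₀ (norm_nonneg _) this
  -- Bessel bounds the contribution of each of the at most `n` basis vectors of `K` by `1`.
  have ht : ∑ a, t a ≤ n := by
    have h1 : ∑ a, t a = ∑ a : S, ‖K.starProjection (e a.1)‖ ^ 2 := by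
      rw [← Finset.sum_subtype (Finset.univ.filter fun a => l a ≠ 0) (by simp)
        (fun a => ‖K.starProjection (e a)‖ ^ 2), Finset.sum_filter]
      exact Finset.sum_congr rfl fun a _ => by by_cases ha : l a = 0 <;> simp [t, ha]
    rw [h1]
    simp only [hP]
    rw [Finset.sum_comm]
    have h2 : ∀ r, ∑ a : S, ‖⟪(b r : H), e a.1⟫_ℂ‖ ^ 2 ≤ 1 := fun r => by
      have := heS.sum_inner_products_le (b r : H) (s := Finset.univ)
      simp only [norm_inner_symm, hbo.1 r] at this
      simpa [norm_inner_symm] using this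
    calc _ ≤ ∑ _r : Fin (Module.finrank ℂ K), (1 : ℝ) := Finset.sum_le_sum fun r _ => h2 r
      _ ≤ n := by simpa using hK
  obtain ⟨hle, heq⟩ := sum_mul_le_sum_castLE hn hnm hanti hl0 hgap ht0 ht1 ht
  rw [hsum]
  refine ⟨hle, fun h => ?_⟩
  -- Weight one means that projection to `K` preserves the norm, so the singular vector lies in `K`.
  -- The dimension bound then leaves no room for anything else.
  have hmem : ∀ a : Fin n, e (Fin.castLE hnm.le a) ∈ K := fun a => by
    have h1 := heq h a
    simp only [t, hfirst a, if_false] at h1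
    rw [Submodule.mem_iff_norm_starProjection, hnorm _ (hfirst a)]
    exact (pow_eq_one_iff_of_nonneg (norm_nonneg _) two_ne_zero).1 h1
  refine (Submodule.eq_of_le_of_finrank_le (Submodule.span_le.2 ?_) ?_).symm
  · rintro _ ⟨a, rfl⟩; exact hmem a
  · rw [finrank_span_eq_card heF.linearIndependent]
    simpa using hK

end EckartYoung

/-! ### Measurable eigenvalues and eigenvectors -/

theorem norm_inner_mulVec_le {m : ℕ} (A : Matrix (Fin m) (Fin m) ℂ)
    (x : EuclideanSpace ℂ (Fin m)) :
    ‖⟪x, WithLp.toLp 2 (A *ᵥ x.ofLp)⟫_ℂ‖ ≤ (∑ i, ∑ j, ‖A i j‖) * ‖x‖ ^ 2 := by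
  rw [PiLp.inner_apply, Finset.sum_mul]
  refine (norm_sum_le _ _).trans (Finset.sum_le_sum fun i _ => ?_)
  simp only [RCLike.inner_apply, Matrix.mulVec, dotProduct, norm_mul, RCLike.norm_conj]
  calc _ ≤ (∑ j, ‖A i j * x j‖) * ‖x i‖ :=
        mul_le_mul_of_nonneg_right (norm_sum_le _ _) (norm_nonneg _)
    _ ≤ (∑ j, ‖A i j‖) * ‖x‖ ^ 2 := by
      rw [Finset.sum_mul, Finset.sum_mul]
      refine Finset.sum_le_sum fun j _ => ?_
      rw [norm_mul, mul_assoc, pow_two]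
      gcongr
      · exact PiLp.norm_apply_le x j
      · exact PiLp.norm_apply_le x i

/-- Weyl's inequality with a crude entrywise bound on the perturbation; applied both ways it gives
continuity, hence measurability, of each eigenvalue. -/
theorem sortedEigenvalue_le_add_norm {m : ℕ} {A B : Matrix (Fin m) (Fin m) ℂ}
    (hA : A.IsHermitian) (hB : B.IsHermitian) (a : Fin m) :
    sortedEigenvalue hA a ≤ sortedEigenvalue hB a + ∑ i, ∑ j, ‖A i j - B i j‖ := by
  refine sortedEigenvalue_le_add hA hB (fun x => ?_) a
  have h := (Complex.re_le_norm _).trans (norm_inner_mulVec_le (A - B) x)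
  rw [Matrix.sub_mulVec, WithLp.toLp_sub, inner_sub_right, Complex.sub_re] at h
  simp only [Matrix.sub_apply] at h
  linarith

/-- Hermitian matrices as a subspace of the arrays of complex numbers. -/
abbrev HermitianArray (m : ℕ) : Type := 
  {A : Fin m → Fin m → ℂ // @Matrix.IsHermitian ℂ (Fin m) _ A}

theorem continuous_sortedEigenvalue {m : ℕ} (a : Fin m) :
    Continuous fun A : HermitianArray m => sortedEigenvalue A.2 a := by
  refine continuous_iff_continuousAt.2 fun A₀ => ?_
  rw [ContinuousAt, tendsto_iff_dist_tendsto_zero]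
  have h0 : Tendsto (fun A : HermitianArray m => ∑ i, ∑ j, ‖A.1 i j - A₀.1 i j‖) (𝓝 A₀) (𝓝 0) := by
    have hcont : Continuous fun A : HermitianArray m => ∑ i, ∑ j, ‖A.1 i j - A₀.1 i j‖ := by
      refine continuous_finsetSum _ fun i _ => continuous_finsetSum _ fun j _ => ?_
      have hij : Continuous fun A : HermitianArray m => A.1 i j :=
        (continuous_apply_apply i j).comp continuous_subtype_val
      exact (hij.sub continuous_const).norm
    simpa using hcont.tendsto A₀
  refine squeeze_zero (fun _ => dist_nonneg) (fun A => ?_) h0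
  rw [Real.dist_eq, abs_sub_le_iff]
  have h1 := sortedEigenvalue_le_add_norm A.2 A₀.2 a
  have h2 := sortedEigenvalue_le_add_norm A₀.2 A.2 a
  simp only [norm_sub_rev (A₀.1 _ _)] at h2
  constructor <;> linarith

theorem measurable_sortedEigenvalue {X : Type*} [MeasurableSpace X] {m : ℕ}
    {B : X → Matrix (Fin m) (Fin m) ℂ} (hB : ∀ i j, Measurable fun x => B x i j)
    (hH : ∀ x, (B x).IsHermitian) (a : Fin m) :
    Measurable fun x => sortedEigenvalue (hH x) a := by
  have hm : Measurable fun x => (⟨B x, hH x⟩ : HermitianArray m) :=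
    Measurable.subtype_mk (measurable_pi_lambda _ fun i => measurable_pi_lambda _ fun j => hB i j)
  exact Measurable.comp (g := fun A : HermitianArray m => sortedEigenvalue A.2 a)
    (f := fun x => (⟨B x, hH x⟩ : HermitianArray m))
    (continuous_sortedEigenvalue a).measurable hm

theorem measurable_toLp_iff {X : Type*} [MeasurableSpace X] {m : ℕ}
    {v : X → EuclideanSpace ℂ (Fin m)} : Measurable v ↔ ∀ i, Measurable fun x => v x i := by
  constructor
  · intro h i
    exact (by fun_prop : Measurable fun y : EuclideanSpace ℂ (Fin m) => y i).comp h
  · intro h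
    exact (MeasurableEquiv.toLp 2 (Fin m → ℂ)).measurable.comp (measurable_pi_lambda _ h)

/-- The iteration `w ↦ w - c⁻¹ M w` started at the `j`-th unit vector. -/
def kernelIterate {m : ℕ} (M : Matrix (Fin m) (Fin m) ℂ) (c : ℝ) (j : Fin m) : ℕ → Fin m → ℂ
  | 0 => (EuclideanSpace.single j (1 : ℂ)).ofLp
  | k + 1 => kernelIterate M c j k - (c⁻¹ : ℂ) • (M *ᵥ kernelIterate M c j k)

/-- In an eigenbasis the iteration multiplies each coordinate by $1-l_a/c$: this fixes the kernel
and, for $0<l_a<c$, contracts the other directions. -/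
theorem kernelIterate_eq {m : ℕ} {M : Matrix (Fin m) (Fin m) ℂ}
    (b : OrthonormalBasis (Fin m) ℂ (EuclideanSpace ℂ (Fin m))) {l : Fin m → ℝ}
    (hb : ∀ a, M *ᵥ (b a).ofLp = (l a : ℂ) • (b a).ofLp) (c : ℝ) (j : Fin m) (k : ℕ) :
    kernelIterate M c j k = ∑ a, ((1 - (c⁻¹ : ℂ) * l a) ^ k *
      ⟪b a, EuclideanSpace.single j (1 : ℂ)⟫_ℂ) • (b a).ofLp := by
  induction k with
  | zero => simpa [kernelIterate] using ofLp_eq_sum_repr b (EuclideanSpace.single j (1 : ℂ))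
  | succ k ih =>
    rw [kernelIterate, ih, Matrix.mulVec_sum, Finset.smul_sum, ← Finset.sum_sub_distrib]
    refine Finset.sum_congr rfl fun a _ => ?_
    rw [Matrix.mulVec_smul, hb, smul_smul, smul_smul, ← sub_smul]
    congr 1
    ring

/-- The projection of the `j`-th unit vector to the kernel is the limit of the iteration. -/
theorem tendsto_kernelIterate {m : ℕ} {M : Matrix (Fin m) (Fin m) ℂ}
    (b : OrthonormalBasis (Fin m) ℂ (EuclideanSpace ℂ (Fin m))) {l : Fin m → ℝ}
    (hb : ∀ a, M *ᵥ (b a).ofLp = (l a : ℂ) • (b a).ofLp) {c : ℝ} (hl : ∀ a, 0 ≤ l a)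
    (hc : ∀ a, l a < c) (j : Fin m) :
    Tendsto (kernelIterate M c j) atTop (𝓝 (∑ a, ((if l a = 0 then 1 else 0) *
      ⟪b a, EuclideanSpace.single j (1 : ℂ)⟫_ℂ) • (b a).ofLp)) := by
  have : kernelIterate M c j = fun k => _ := funext fun k => kernelIterate_eq b hb c j k
  rw [this]
  refine tendsto_finsetSum _ fun a _ => Tendsto.smul_const (Tendsto.mul_const _ ?_) _
  split_ifs with h
  · have e : (fun k : ℕ => (1 - (c⁻¹ : ℂ) * l a) ^ k) = fun _ => 1 := by simp [h]
    exact Tendsto.congr (fun k => (congrFun e k).symm) tendsto_const_nhds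
  · refine tendsto_pow_atTop_nhds_zero_of_norm_lt_one ?_
    have hpos : 0 < l a := lt_of_le_of_ne (hl a) (Ne.symm h)
    have hcp : 0 < c := hpos.trans (hc a)
    have e : (1 - (c⁻¹ : ℂ) * l a) = ((1 - c⁻¹ * l a : ℝ) : ℂ) := by push_cast; ring
    rw [e, Complex.norm_real, Real.norm_eq_abs, abs_lt]
    have h1 : c⁻¹ * l a < 1 := by rw [inv_mul_lt_iff₀ hcp]; simpa using hc a
    have h2 : 0 < c⁻¹ * l a := by positivity
    constructor <;> linarith

theorem exists_measurable_ne_zero {X : Type*} [MeasurableSpace X] {m n : ℕ}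
    (p : Fin n → X → EuclideanSpace ℂ (Fin m)) (hp : ∀ j, Measurable (p j))
    (h : ∀ x, ∃ j, p j x ≠ 0) :
    ∃ w : X → EuclideanSpace ℂ (Fin m), Measurable w ∧ ∀ x, w x ≠ 0 ∧ ∃ j, w x = p j x := by
  classical
  suffices H : ∀ s : Finset (Fin n), ∃ w : X → EuclideanSpace ℂ (Fin m), Measurable w ∧
      ∀ x, (w x = 0 ∨ ∃ j, w x = p j x) ∧ (w x = 0 → ∀ j ∈ s, p j x = 0) by
    obtain ⟨w, hw, hw'⟩ := H Finset.univ
    refine ⟨w, hw, fun x => ?_⟩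
    have hne : w x ≠ 0 := fun h0 => by
      obtain ⟨j, hj⟩ := h x
      exact hj ((hw' x).2 h0 j (Finset.mem_univ j))
    exact ⟨hne, (hw' x).1.resolve_left hne⟩
  intro s
  induction s using Finset.induction_on with
  | empty => exact ⟨fun _ => 0, measurable_const, fun x => ⟨Or.inl rfl, by simp⟩⟩
  | insert j s hj ih =>
    obtain ⟨w, hw, hw'⟩ := ih
    refine ⟨fun x => if p j x = 0 then w x else p j x,
      Measurable.ite (hp j (measurableSet_singleton 0)) hw (hp j), fun x => ?_⟩
    by_cases hx : p j x = 0
    · simp only [hx, if_true]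
      refine ⟨(hw' x).1, fun h0 i hi => ?_⟩
      rcases Finset.mem_insert.1 hi with rfl | hi
      · exact hx
      · exact (hw' x).2 h0 i hi
    · simp only [hx, if_false]
      exact ⟨Or.inr ⟨j, rfl⟩, fun h0 => h0.elim⟩

/-- A measurable field of singular matrices has a measurable field of unit kernel vectors. -/
theorem exists_measurable_unit_kernel {X ι : Type*} [MeasurableSpace X] [Fintype ι] {m : ℕ}
    {N : X → Matrix ι (Fin m) ℂ} (hN : ∀ i j, Measurable fun x => N x i j)
    (hker : ∀ x, ∃ v : EuclideanSpace ℂ (Fin m), v ≠ 0 ∧ N x *ᵥ v.ofLp = 0) :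
    ∃ v : X → EuclideanSpace ℂ (Fin m), Measurable v ∧
      ∀ x, ‖v x‖ = 1 ∧ N x *ᵥ (v x).ofLp = 0 := by
  -- `M` is positive semidefinite with the same kernel as `N`. The eigenbasis of `M` depends on `x`
  -- in no controlled way, but the kernel projections are limits of iterates that are visibly
  -- measurable.
  let M : X → Matrix (Fin m) (Fin m) ℂ := fun x => (N x)ᴴ * N x
  have hM : ∀ i j, Measurable fun x => M x i j := by
    intro i j
    simp only [M, Matrix.mul_apply, Matrix.conjTranspose_apply]
    exact Finset.measurable_sum _ fun k _ =>
      (Complex.continuous_conj.measurable.comp (hN k i)).mul (hN k j)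
  have hpsd : ∀ x, (M x).PosSemidef := fun x => Matrix.posSemidef_conjTranspose_mul_self _
  have hMN : ∀ x (v : Fin m → ℂ), M x *ᵥ v = 0 ↔ N x *ᵥ v = 0 := fun x v =>
    Matrix.conjTranspose_mul_self_mulVec_eq_zero _ _
  let b := fun x => (hpsd x).1.eigenvectorBasis
  let l := fun x => (hpsd x).1.eigenvalues
  have hb : ∀ x a, M x *ᵥ (b x a).ofLp = (l x a : ℂ) • (b x a).ofLp := fun x a =>
    (hpsd x).1.mulVec_eigenvectorBasis a
  have hl : ∀ x a, 0 ≤ l x a := fun x a => (hpsd x).eigenvalues_nonneg a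
  -- One plus the trace is measurable in `x` and exceeds every eigenvalue.
  let c : X → ℝ := fun x => 1 + (M x).trace.re
  have hc : ∀ x a, l x a < c x := by
    intro x a
    have h1 : (M x).trace.re = ∑ a, l x a := by
      rw [(hpsd x).1.trace_eq_sum_eigenvalues]; simp [l]
    have h2 := Finset.single_le_sum (fun a _ => hl x a) (Finset.mem_univ a)
    simp only [c, h1]
    linarith
  have hcm : Measurable c := by
    refine measurable_const.add (Complex.measurable_re.comp ?_)
    simp only [Matrix.trace, Matrix.diag]
    exact Finset.measurable_sum _ fun i _ => hM i i
  have hw : ∀ j k, Measurable fun x => kernelIterate (M x) (c x) j k := by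
    intro j k
    induction k with
    | zero => exact measurable_const
    | succ k ih =>
      refine measurable_pi_lambda _ fun i => ?_
      simp only [kernelIterate, Pi.sub_apply, Pi.smul_apply, smul_eq_mul, Matrix.mulVec, dotProduct]
      refine ((measurable_pi_apply i).comp ih).sub
        ((Complex.measurable_ofReal.comp hcm).inv.mul ?_)
      exact Finset.measurable_sum _ fun r _ => (hM i r).mul ((measurable_pi_apply r).comp ih)
  let p : Fin m → X → EuclideanSpace ℂ (Fin m) := fun j x => WithLp.toLp 2
    (∑ a, ((if l x a = 0 then 1 else 0) * ⟪b x a, EuclideanSpace.single j (1 : ℂ)⟫_ℂ) •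
      (b x a).ofLp)
  have hp : ∀ j, Measurable (p j) := fun j =>
    (MeasurableEquiv.toLp 2 (Fin m → ℂ)).measurable.comp
      (measurable_of_tendsto_metrizable (hw j) (tendsto_pi_nhds.2 fun x =>
        tendsto_kernelIterate (b x) (hb x) (hl x) (hc x) j))
  have hpker : ∀ j x, M x *ᵥ (p j x).ofLp = 0 := by
    intro j x
    simp only [p]
    rw [Matrix.mulVec_sum]
    refine Finset.sum_eq_zero fun a _ => ?_
    rw [Matrix.mulVec_smul, hb]
    split_ifs with h <;> simp [h]
  have hpne : ∀ x, ∃ j, p j x ≠ 0 := by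
    intro x
    -- If every unit vector projected to zero, the kernel would be trivial and `M` definite, against
    -- the given kernel vector.
    by_contra! hcon
    obtain ⟨v, hv0, hv⟩ := hker x
    rw [← hMN] at hv
    refine hv0 ?_
    have hpe : ∀ j, p j x = ∑ a, ((if l x a = 0 then 1 else 0) *
        ⟪b x a, EuclideanSpace.single j (1 : ℂ)⟫_ℂ) • b x a := by
      intro j; ext i; simp only [p, WithLp.ofLp_sum, WithLp.ofLp_smul]
    have hzero : ∀ a, l x a = 0 → ∀ j, ⟪b x a, EuclideanSpace.single j (1 : ℂ)⟫_ℂ = 0 := by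
      intro a ha j
      have h1 := congrArg (fun z => ⟪b x a, z⟫_ℂ) ((hpe j).symm.trans (hcon j))
      simp only [inner_zero_right] at h1
      rw [(b x).orthonormal.inner_right_fintype] at h1
      simpa [ha] using h1
    have hall : ∀ a, l x a ≠ 0 := by
      intro a ha
      have hba : b x a = 0 := by
        ext j
        have := hzero a ha j
        rw [EuclideanSpace.inner_single_right] at this
        simpa using this
      have := (b x).orthonormal.1 a
      rw [hba, norm_zero] at this
      exact zero_ne_one this
    have hsum := inner_mulVec_eq_sum (b x) (hb x) v
    rw [hv, WithLp.toLp_zero, inner_zero_right] at hsum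
    have h2 := (Finset.sum_eq_zero_iff_of_nonneg fun a _ =>
      mul_nonneg (hl x a) (sq_nonneg ‖⟪b x a, v⟫_ℂ‖)).1 (Complex.ofReal_eq_zero.1 hsum.symm)
    rw [← (b x).sum_repr' v]
    refine Finset.sum_eq_zero fun a _ => ?_
    have h3 := h2 a (Finset.mem_univ a)
    rcases mul_eq_zero.1 h3 with h | h
    · exact absurd h (hall a)
    · simp [norm_eq_zero.1 (pow_eq_zero_iff two_ne_zero |>.1 h)]
  obtain ⟨w, hwm, hw'⟩ := exists_measurable_ne_zero p hp hpne
  refine ⟨fun x => ((‖w x‖⁻¹ : ℝ) : ℂ) • w x,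
    (Complex.measurable_ofReal.comp hwm.norm.inv).smul hwm, fun x => ⟨?_, ?_⟩⟩
  · have := norm_ne_zero_iff.2 (hw' x).1
    rw [norm_smul, Complex.norm_real, norm_inv, norm_norm, inv_mul_cancel₀ this]
  · obtain ⟨j, hj⟩ := (hw' x).2
    rw [← hMN, WithLp.ofLp_smul, Matrix.mulVec_smul, hj, hpker, smul_zero]

/-- Eigenvectors of a Hermitian matrix for different eigenvalues are orthogonal. -/
theorem inner_eq_zero_of_eigenvalue_ne {m : ℕ} {A : Matrix (Fin m) (Fin m) ℂ}
    (hA : A.IsHermitian) {x y : EuclideanSpace ℂ (Fin m)} {p q : ℝ}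
    (hx : A *ᵥ x.ofLp = (p : ℂ) • x.ofLp) (hy : A *ᵥ y.ofLp = (q : ℂ) • y.ofLp) (hpq : p ≠ q) :
    ⟪x, y⟫_ℂ = 0 := by
  have h1 : (A *ᵥ y.ofLp) ⬝ᵥ star x.ofLp = y.ofLp ⬝ᵥ star (A *ᵥ x.ofLp) := by
    rw [Matrix.star_mulVec, hA.eq, dotProduct_comm, Matrix.dotProduct_mulVec, dotProduct_comm]
  rw [hx, hy, star_smul, smul_dotProduct, dotProduct_smul, ← inner_eq_dotProduct] at h1
  simp only [smul_eq_mul, RCLike.star_def, Complex.conj_ofReal] at h1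
  have h2 : ((q : ℂ) - p) * ⟪x, y⟫_ℂ = 0 := by rw [sub_mul, h1, sub_self]
  refine (mul_eq_zero.1 h2).resolve_left fun h => hpq ?_
  exact_mod_cast (sub_eq_zero.1 h).symm

/-- Orthonormal eigenvectors for the first eigenvalues can be extended by another one. -/
theorem exists_next_eigenvector {m : ℕ} {A : Matrix (Fin m) (Fin m) ℂ} (hA : A.IsHermitian)
    (i : Fin m) (y : Fin m → EuclideanSpace ℂ (Fin m))
    (hy : ∀ j < i, A *ᵥ (y j).ofLp = (sortedEigenvalue hA j : ℂ) • (y j).ofLp) :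
    ∃ x : EuclideanSpace ℂ (Fin m), x ≠ 0 ∧
      A *ᵥ x.ofLp = (sortedEigenvalue hA i : ℂ) • x.ofLp ∧ ∀ j < i, ⟪y j, x⟫_ℂ = 0 := by
  classical
  obtain ⟨b, hb⟩ := exists_eigenbasis hA
  -- One condition for each `j ≠ i`: earlier `y j` with the same eigenvalue are excluded directly,
  -- and the `b j` with other eigenvalues force `x` into the eigenspace. Earlier `y j` with other
  -- eigenvalues are then orthogonal automatically.
  obtain ⟨x, hx0, hx⟩ := exists_ne_zero_orthogonal i fun j =>
    if j < i ∧ sortedEigenvalue hA j = sortedEigenvalue hA i then y j else b j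
  have hbx : ∀ j, sortedEigenvalue hA j ≠ sortedEigenvalue hA i → ⟪b j, x⟫_ℂ = 0 := by
    intro j hj
    have := hx j (fun h => hj (h ▸ rfl))
    simpa [hj] using this
  have hbx' : ∀ j, ⟪b j, x⟫_ℂ * (sortedEigenvalue hA j : ℂ) =
      (sortedEigenvalue hA i : ℂ) * ⟪b j, x⟫_ℂ := by
    intro j
    by_cases hj : sortedEigenvalue hA j = sortedEigenvalue hA i
    · rw [hj, mul_comm]
    · simp [hbx j hj]
  have heig : A *ᵥ x.ofLp = (sortedEigenvalue hA i : ℂ) • x.ofLp := by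
    rw [mulVec_eq_sum b hb x]
    conv_rhs => rw [ofLp_eq_sum_repr b x, Finset.smul_sum]
    exact Finset.sum_congr rfl fun j _ => by rw [hbx' j, smul_smul]
  refine ⟨x, hx0, heig, fun j hj => ?_⟩
  by_cases h : sortedEigenvalue hA j = sortedEigenvalue hA i
  · have := hx j hj.ne
    simpa [hj, h] using this
  · exact inner_eq_zero_of_eigenvalue_ne hA (hy j hj) heig h

/-- A measurable field of Hermitian matrices has a measurable field of orthonormal eigenbases,
sorted by decreasing eigenvalues. -/
theorem exists_measurable_eigenvectors {X : Type*} [MeasurableSpace X] {m : ℕ}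
    {B : X → Matrix (Fin m) (Fin m) ℂ} (hB : ∀ i j, Measurable fun x => B x i j)
    (hH : ∀ x, (B x).IsHermitian) :
    ∃ y : Fin m → X → EuclideanSpace ℂ (Fin m), (∀ i, Measurable (y i)) ∧
      ∀ x, Orthonormal ℂ (fun i => y i x) ∧
        ∀ i, B x *ᵥ (y i x).ofLp = (sortedEigenvalue (hH x) i : ℂ) • (y i x).ofLp := by
  classical
  suffices H : ∀ k : ℕ, k ≤ m → ∃ y : Fin m → X → EuclideanSpace ℂ (Fin m),
      (∀ i, Measurable (y i)) ∧ ∀ x, (∀ i : Fin m, (i : ℕ) < k → ‖y i x‖ = 1) ∧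
        (∀ i j : Fin m, (i : ℕ) < k → j < i → ⟪y j x, y i x⟫_ℂ = 0) ∧
        ∀ i : Fin m, (i : ℕ) < k →
          B x *ᵥ (y i x).ofLp = (sortedEigenvalue (hH x) i : ℂ) • (y i x).ofLp by
    obtain ⟨y, hy, hy'⟩ := H m le_rfl
    refine ⟨y, hy, fun x => ⟨⟨fun i => (hy' x).1 i i.2, fun i j hij => ?_⟩,
      fun i => (hy' x).2.2 i i.2⟩⟩
    rcases lt_or_gt_of_ne hij with h | h
    · exact (hy' x).2.1 j i j.2 h
    · exact inner_eq_zero_symm.1 ((hy' x).2.1 i j i.2 h)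
  intro k
  induction k with
  | zero => exact fun _ => ⟨fun _ _ => 0, fun _ => measurable_const, fun x => by simp⟩
  | succ k ih =>
    intro hk
    obtain ⟨y, hy, hy'⟩ := ih (by omega)
    let i : Fin m := ⟨k, by omega⟩
    -- Stacking the eigenvalue equation on the orthogonality conditions makes the admissible next
    -- eigenvectors the kernel of one measurable matrix field.
    let N : X → Matrix (Fin m ⊕ Fin m) (Fin m) ℂ := fun x => Matrix.fromRows
      (B x - (sortedEigenvalue (hH x) i : ℂ) • (1 : Matrix (Fin m) (Fin m) ℂ))
      (Matrix.of fun j r => if j < i then conj (y j x r) else 0)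
    have hN : ∀ r s, Measurable fun x => N x r s := by
      rintro (r | r) s
      · simp only [N, Matrix.fromRows_apply_inl, Matrix.sub_apply, Matrix.smul_apply, smul_eq_mul]
        exact (hB r s).sub ((Complex.measurable_ofReal.comp
          (measurable_sortedEigenvalue hB hH i)).mul_const _)
      · simp only [N, Matrix.fromRows_apply_inr, Matrix.of_apply]
        split_ifs
        · exact Complex.continuous_conj.measurable.comp (measurable_toLp_iff.1 (hy r) s)
        · exact measurable_const
    have hNz : ∀ x (v : EuclideanSpace ℂ (Fin m)), N x *ᵥ v.ofLp = 0 ↔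
        B x *ᵥ v.ofLp = (sortedEigenvalue (hH x) i : ℂ) • v.ofLp ∧
          ∀ j < i, ⟪y j x, v⟫_ℂ = 0 := by
      intro x v
      have hrow : ∀ j, (Matrix.of (fun j r => if j < i then conj (y j x r) else 0) *ᵥ v.ofLp) j =
          if j < i then ⟪y j x, v⟫_ℂ else 0 := by
        intro j
        split_ifs with h <;> simp [Matrix.mulVec, dotProduct, h, PiLp.inner_apply, mul_comm]
      simp only [N, Matrix.fromRows_mulVec]
      constructor
      · intro h
        refine ⟨?_, fun j hj => ?_⟩
        · have h1 : (B x - (sortedEigenvalue (hH x) i : ℂ) • (1 : Matrix (Fin m) (Fin m) ℂ)) *ᵥ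
              v.ofLp = 0 := funext fun r => congrFun h (Sum.inl r)
          rwa [Matrix.sub_mulVec, Matrix.smul_mulVec, Matrix.one_mulVec, sub_eq_zero] at h1
        · have h1 := congrFun h (Sum.inr j)
          rw [Sum.elim_inr, hrow, if_pos hj] at h1
          exact h1
      · rintro ⟨h1, h2⟩
        funext r
        rcases r with r | r
        · rw [Sum.elim_inl, Matrix.sub_mulVec, Matrix.smul_mulVec, Matrix.one_mulVec, h1, sub_self]
          rfl
        · rw [Sum.elim_inr, hrow]
          split_ifs with h
          · exact h2 r h
          · rfl
    obtain ⟨v, hv, hv'⟩ := exists_measurable_unit_kernel hN fun x => by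
      obtain ⟨w, hw0, hw1, hw2⟩ := exists_next_eigenvector (hH x) i (fun j => y j x)
        fun j hj => (hy' x).2.2 j hj
      exact ⟨w, hw0, (hNz x w).2 ⟨hw1, hw2⟩⟩
    refine ⟨Function.update y i v, fun j => ?_, fun x => ?_⟩
    · by_cases hj : j = i
      · subst hj; simpa using hv
      · simpa [hj] using hy j
    obtain ⟨e1, e2⟩ := (hNz x (v x)).1 (hv' x).2
    have hne : ∀ j : Fin m, (j : ℕ) < k → j ≠ i := fun j hj h => by
      rw [h] at hj; exact lt_irrefl _ hj
    have hcase : ∀ j : Fin m, (j : ℕ) < k + 1 → (j : ℕ) < k ∨ j = i := fun j hj => by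
      rcases Nat.lt_succ_iff_lt_or_eq.1 hj with h | h
      · exact Or.inl h
      · exact Or.inr (Fin.ext h)
    refine ⟨fun j hj => ?_, fun j r hj hr => ?_, fun j hj => ?_⟩
    · rcases hcase j hj with h | h
      · rw [Function.update_of_ne (hne j h)]
        exact (hy' x).1 j h
      · subst h
        rw [Function.update_self]
        exact (hv' x).1
    · rcases hcase j hj with h | h
      · rw [Function.update_of_ne (hne j h), Function.update_of_ne (hne r (lt_trans hr h))]
        exact (hy' x).2.1 j r h hr
      · subst h
        rw [Function.update_self, Function.update_of_ne hr.ne]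
        exact e2 r hr
    · rcases hcase j hj with h | h
      · rw [Function.update_of_ne (hne j h)]
        exact (hy' x).2.2 j h
      · subst h
        rw [Function.update_self]
        exact e1

/-! ### The eigenvectors of the Gramian -/

theorem measurable_eigenvalue {d m : ℕ} (f : Fin m → L2 d) (i : Fin m) :
    Measurable fun ω => eigenvalue f ω i :=
  measurable_sortedEigenvalue (measurable_gramian f) (gramian_isHermitian f) i

theorem measurable_sigmaTilde {d m : ℕ} (f : Fin m → L2 d) (i : Fin m) :
    Measurable fun ω => sigmaTilde f ω i :=
  Measurable.ite (measurable_eigenvalue f i (measurableSet_singleton 0)) measurable_const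
    ((measurable_eigenvalue f i).pow_const _)

theorem exists_eigenvectorChoice {d m n : ℕ} (f : Fin m → L2 d) (hnm : n ≤ m) :
    ∃ y : Fin n → Space d → EuclideanSpace ℂ (Fin m), IsEigenvectorChoice f hnm y := by
  -- The selection is made on the space of matrices, not of frequencies, so periodicity is inherited
  -- from the Gramian. The transpose turns right eigenvectors into left ones.
  obtain ⟨z, hz, hz'⟩ := exists_measurable_eigenvectors (X := HermitianArray m)
    (B := fun A => Matrix.transpose A.1)
    (fun i j => (measurable_pi_apply i).comp ((measurable_pi_apply j).comp measurable_subtype_coe))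
    (fun A => A.2.transpose)
  let G : Space d → HermitianArray m := fun ω => ⟨gramian f ω, gramian_isHermitian f ω⟩
  have hG : Measurable G := Measurable.subtype_mk
    (measurable_pi_lambda _ fun i => measurable_pi_lambda _ fun j => measurable_gramian f i j)
  have hGp : ∀ ω k, G (ω + latticeVec k) = G ω := fun ω k =>
    Subtype.ext (gramian_add_latticeVec f ω k)
  refine ⟨fun i ω => z (Fin.castLE hnm i) (G ω), fun i => (hz _).comp hG,
    fun i k => ae_of_all _ fun ω => by rw [hGp], ae_of_all _ fun ω => ?_,
    fun i => ae_of_all _ fun ω => ?_⟩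
  · exact (hz' (G ω)).1.comp _ (Fin.castLE_injective hnm)
  · have h := (hz' (G ω)).2 (Fin.castLE hnm i)
    rw [Matrix.mulVec_transpose, sortedEigenvalue_transpose (G ω).2] at h
    exact h

/-! ### Shift-invariant spaces and their fiber spaces -/

/-- The span of the fibers of the generators. -/
def fiberSpan {d : ℕ} {ι : Type*} (Φ : ι → L2 d) (ω : Space d) :
    Submodule ℂ (lp (fun _ : Fin d → ℤ => ℂ) 2) :=
  Submodule.span ℂ (Set.range fun i => fiber (Φ i) ω)

instance {d : ℕ} {ι : Type*} [Finite ι] (Φ : ι → L2 d) (ω : Space d) :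
    FiniteDimensional ℂ (fiberSpan Φ ω) :=
  FiniteDimensional.span_of_finite ℂ (Set.finite_range _)

theorem mem_orthogonal_shiftInvariantSpace_iff {d : ℕ} {ι : Type*} (Φ : ι → L2 d) (h : L2 d) :
    h ∈ (shiftInvariantSpace Φ).toSubmoduleᗮ ↔
      ∀ i, ∀ᵐ ω ∂cubeMeasure d, ⟪fiber (Φ i) ω, fiber h ω⟫_ℂ = 0 := by
  have e : (shiftInvariantSpace Φ).toSubmodule =
      (Submodule.span ℂ (Set.range (translates Φ))).topologicalClosure := rfl
  rw [e, Submodule.orthogonal_closure]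
  simp only [← forall_inner_translate_eq_zero_iff]
  rw [Submodule.mem_orthogonal]
  constructor
  · intro H i k
    exact H _ (Submodule.subset_span ⟨(i, k), rfl⟩)
  · intro H u hu
    induction hu using Submodule.span_induction with
    | mem u hu =>
      obtain ⟨⟨i, k⟩, rfl⟩ := hu
      exact H i k
    | zero => exact inner_zero_left _
    | add x y _ _ hx hy => rw [inner_add_left, hx, hy, add_zero]
    | smul c x _ hx => rw [inner_smul_left, hx, mul_zero]

/-- By the isometry, the squared norms of the fibers of `x n - w` tend to zero in $L^1$ of the cube,
hence almost everywhere along a subsequence. -/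
theorem exists_seq_tendsto_fiber {d : ℕ} {x : ℕ → L2 d} {w : L2 d}
    (hx : Tendsto x atTop (𝓝 w)) : ∃ ns : ℕ → ℕ, ∀ᵐ ω ∂cubeMeasure d,
      Tendsto (fun i => fiber (x (ns i)) ω) atTop (𝓝 (fiber w ω)) := by
  let g : ℕ → Space d → ℝ := fun n ω => ‖fiber (x n - w) ω‖ ^ 2
  have hg : ∀ n, Integrable (g n) (cubeMeasure d) := fun n => integrable_norm_fiber_sq _
  have hL : Tendsto (fun n => eLpNorm (g n - 0) 1 (cubeMeasure d)) atTop (𝓝 0) := by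
    have e : ∀ n, eLpNorm (g n - 0) 1 (cubeMeasure d) = ENNReal.ofReal (‖x n - w‖ ^ 2) := by
      intro n
      rw [sub_zero, eLpNorm_one_eq_lintegral_enorm,
        ← ofReal_integral_norm_eq_lintegral_enorm (hg n), ← integral_norm_fiber_sq]
      simp [g]
    simp only [e]
    have h1 : Tendsto (fun n => ‖x n - w‖ ^ 2) atTop (𝓝 0) := by
      have := (tendsto_iff_norm_sub_tendsto_zero.1 hx).pow 2
      simpa using this
    simpa using ENNReal.tendsto_ofReal h1
  obtain ⟨ns, -, hns⟩ := (tendstoInMeasure_of_tendsto_eLpNorm one_ne_zero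
    (fun n => (hg n).1) aestronglyMeasurable_zero hL).exists_seq_tendsto_ae
  refine ⟨ns, ?_⟩
  have hsub := ae_all_iff.2 fun n => fiber_sub (x n) w
  filter_upwards [hns, hsub] with ω h1 h2
  rw [tendsto_iff_norm_sub_tendsto_zero]
  have h3 := (Real.continuous_sqrt.tendsto _).comp h1
  simp only [Pi.zero_apply, Real.sqrt_zero] at h3
  refine h3.congr fun i => ?_
  simp only [Function.comp_apply, g, Real.sqrt_sq (norm_nonneg _), h2]

/-- Clear for finite combinations of translates. It survives limits because fibers converge along a
subsequence and a finite-dimensional fiber space is closed. -/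
theorem fiber_mem_fiberSpan {d : ℕ} {ι : Type*} [Finite ι] {Φ : ι → L2 d} {w : L2 d}
    (hw : w ∈ shiftInvariantSpace Φ) : ∀ᵐ ω ∂cubeMeasure d, fiber w ω ∈ fiberSpan Φ ω := by
  have hspan : ∀ u ∈ Submodule.span ℂ (Set.range (translates Φ)),
      ∀ᵐ ω ∂cubeMeasure d, fiber u ω ∈ fiberSpan Φ ω := by
    intro u hu
    induction hu using Submodule.span_induction with
    | mem u hu =>
      obtain ⟨⟨i, k⟩, rfl⟩ := hu
      filter_upwards [fiber_translate k (Φ i)] with ω hω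
      rw [translates, hω]
      exact Submodule.smul_mem _ _ (Submodule.subset_span ⟨i, rfl⟩)
    | zero =>
      filter_upwards [fiber_zero (d := d)] with ω hω
      rw [hω]; exact Submodule.zero_mem _
    | add x y _ _ hx hy =>
      filter_upwards [fiber_add x y, hx, hy] with ω hω h1 h2
      rw [hω]; exact Submodule.add_mem _ h1 h2
    | smul c x _ hx =>
      filter_upwards [fiber_smul c x, hx] with ω hω h1
      rw [hω]; exact Submodule.smul_mem _ _ h1
  have hcl : w ∈ closure (Submodule.span ℂ (Set.range (translates Φ)) : Set (L2 d)) := hw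
  obtain ⟨x, hx, hlim⟩ := mem_closure_iff_seq_limit.1 hcl
  obtain ⟨ns, hns⟩ := exists_seq_tendsto_fiber hlim
  filter_upwards [hns, ae_all_iff.2 fun n => hspan (x n) (hx n)] with ω h1 h2
  exact (fiberSpan Φ ω).closed_of_finiteDimensional.mem_of_tendsto h1
    (Eventually.of_forall fun i => h2 _)

/-- The projection to a shift-invariant space acts fiberwise. -/
theorem fiber_starProjection {d : ℕ} {ι : Type*} [Finite ι] (Φ : ι → L2 d) (g : L2 d) :
    ∀ᵐ ω ∂cubeMeasure d, fiber ((shiftInvariantSpace Φ).toSubmodule.starProjection g) ω =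
      (fiberSpan Φ ω).starProjection (fiber g ω) := by
  set W := (shiftInvariantSpace Φ).toSubmodule
  have h1 := fiber_mem_fiberSpan (Φ := Φ) (w := W.starProjection g) (W.starProjection_apply_mem g)
  have h2 := ae_all_iff.2 ((mem_orthogonal_shiftInvariantSpace_iff Φ _).1
    (W.sub_starProjection_mem_orthogonal g))
  filter_upwards [h1, h2, fiber_sub g (W.starProjection g)] with ω h1 h2 h3
  refine (Submodule.eq_starProjection_of_mem_of_inner_eq_zero h1 fun z hz => ?_).symm
  rw [h3] at h2
  induction hz using Submodule.span_induction with
  | mem z hz =>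
    obtain ⟨i, rfl⟩ := hz
    exact inner_eq_zero_symm.1 (h2 i)
  | zero => exact inner_zero_right _
  | add x y _ _ hx hy => rw [inner_add_right, hx, hy, add_zero]
  | smul c x _ hx => rw [inner_smul_right, hx, mul_zero]

theorem mem_shiftInvariantSpace_iff {d : ℕ} {ι : Type*} [Finite ι] (Φ : ι → L2 d) (w : L2 d) :
    w ∈ shiftInvariantSpace Φ ↔ ∀ᵐ ω ∂cubeMeasure d, fiber w ω ∈ fiberSpan Φ ω := by
  refine ⟨fiber_mem_fiberSpan, fun h => ?_⟩
  set W := (shiftInvariantSpace Φ).toSubmodule with hW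
  have hz : ‖w - W.starProjection w‖ ^ 2 = 0 := by
    rw [← integral_norm_fiber_sq]
    refine integral_eq_zero_of_ae ?_
    filter_upwards [h, fiber_starProjection Φ w, fiber_sub w (W.starProjection w)] with ω h1 h2 h3
    rw [h3, h2, Submodule.starProjection_eq_self_iff.2 h1]
    simp
  have := sub_eq_zero.1 (norm_eq_zero.1 ((pow_eq_zero_iff two_ne_zero).1 hz))
  exact Submodule.starProjection_eq_self_iff.1 this.symm

theorem shiftInvariantSpace_eq_of_fiberSpan_eq {d : ℕ} {ι κ : Type*} [Finite ι] [Finite κ]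
    {Φ : ι → L2 d} {Ψ : κ → L2 d}
    (h : ∀ᵐ ω ∂cubeMeasure d, fiberSpan Φ ω = fiberSpan Ψ ω) :
    shiftInvariantSpace Φ = shiftInvariantSpace Ψ := by
  refine SetLike.ext fun w => ?_
  rw [mem_shiftInvariantSpace_iff, mem_shiftInvariantSpace_iff]
  exact eventually_congr (h.mono fun ω hω => by rw [hω])

/-! ### The error in terms of fibers -/

/-- The energy of the fibers of the data captured by the fiber space. -/
def capturedEnergy {d m : ℕ} {ι : Type*} [Finite ι] (f : Fin m → L2 d) (Φ : ι → L2 d)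
    (ω : Space d) : ℝ :=
  ∑ i, ‖(fiberSpan Φ ω).starProjection (fiber (f i) ω)‖ ^ 2

/-- Replaces projections onto a varying subspace by fibers of fixed $L^2$ functions, which settles
measurability and integrability. -/
theorem capturedEnergy_ae_eq {d m : ℕ} {ι : Type*} [Finite ι] (f : Fin m → L2 d) (Φ : ι → L2 d) :
    capturedEnergy f Φ =ᵐ[cubeMeasure d] fun ω =>
      ∑ i, ‖fiber ((shiftInvariantSpace Φ).toSubmodule.starProjection (f i)) ω‖ ^ 2 := by
  filter_upwards [ae_all_iff.2 fun i => fiber_starProjection Φ (f i)] with ω hω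
  simp only [capturedEnergy, hω]

theorem integrable_capturedEnergy {d m : ℕ} {ι : Type*} [Finite ι] (f : Fin m → L2 d)
    (Φ : ι → L2 d) : Integrable (capturedEnergy f Φ) (cubeMeasure d) :=
  (integrable_congr (capturedEnergy_ae_eq f Φ)).2
    (integrable_finsetSum _ fun _ _ => integrable_norm_fiber_sq _)

theorem error_shiftInvariantSpace {d m : ℕ} {ι : Type*} [Finite ι] (f : Fin m → L2 d)
    (Φ : ι → L2 d) : error f (shiftInvariantSpace Φ) =
      ∑ i, ‖f i‖ ^ 2 - ∫ ω, capturedEnergy f Φ ω ∂cubeMeasure d := by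
  rw [integral_congr_ae (capturedEnergy_ae_eq f Φ),
    integral_finsetSum _ fun i _ => integrable_norm_fiber_sq _, error, ← Finset.sum_sub_distrib]
  refine Finset.sum_congr rfl fun i _ => ?_
  rw [integral_norm_fiber_sq, Submodule.norm_sq_eq_add_norm_sq_starProjection (f i)
    (shiftInvariantSpace Φ).toSubmodule, Submodule.starProjection_orthogonal_val]
  ring

/-! ### Optimality -/

section Gap

variable {d m n : ℕ} (hn : 1 ≤ n) (hnm : n < m) (f : Fin m → L2 d)
  (hgap : ∀ᵐ ω : Space d, eigenvalue f ω ⟨n, hnm⟩ <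
    eigenvalue f ω ⟨n - 1, (Nat.sub_le n 1).trans_lt hnm⟩)

-- The chain $\lambda_a\ge\lambda_n>\lambda_{n+1}\ge0$, the last step because the Gramian is a Gram
-- matrix.
include hgap in
theorem ae_cube_eigenvalue_pos : ∀ᵐ ω ∂cubeMeasure d, ∀ a : Fin n,
    0 < eigenvalue f ω (Fin.castLE hnm.le a) := by
  filter_upwards [ae_restrict_of_ae hgap, gramian_apply f] with ω h1 h2 a
  refine lt_of_lt_of_le (lt_of_le_of_lt
    (sortedEigenvalue_nonneg_of_gram h2 (gramian_isHermitian f ω) _) h1) ?_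
  exact sortedEigenvalue_antitone (gramian_isHermitian f ω) (by rw [Fin.le_def]; simp; omega)

include hgap in
theorem ae_le_rank_gramian : ∀ᵐ ω : Space d, n ≤ (gramian f ω).rank := by
  refine ae_of_ae_cube_of_periodic ?_ fun ω k h => by rwa [gramian_add_latticeVec]
  filter_upwards [ae_cube_eigenvalue_pos hnm f hgap] with ω hω
  exact le_rank_of_sortedEigenvalue_pos (gramian_isHermitian f ω) hnm.le fun a => (hω a).ne'

-- The exceptional null set and `K₀` do not depend on the generators, which is what lets two optimal
-- spaces be compared fiber by fiber.
include hn hgap in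
theorem ae_exists_best_fiberSpan : ∀ᵐ ω ∂cubeMeasure d,
    ∃ K₀ : Submodule ℂ (lp (fun _ : Fin d → ℤ => ℂ) 2), ∀ (s : ℕ) (_ : s ≤ n) (Φ : Fin s → L2 d),
      capturedEnergy f Φ ω ≤ ∑ a : Fin n, eigenvalue f ω (Fin.castLE hnm.le a) ∧
      (capturedEnergy f Φ ω = ∑ a : Fin n, eigenvalue f ω (Fin.castLE hnm.le a) →
        fiberSpan Φ ω = K₀) := by
  filter_upwards [ae_restrict_of_ae hgap, gramian_apply f] with ω h1 h2
  obtain ⟨K₀, hK₀⟩ := exists_unique_best_subspace h2 hn hnm (gramian_isHermitian f ω) h1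
  refine ⟨K₀, fun s hs Φ => ?_⟩
  refine hK₀ (fiberSpan Φ ω) (le_trans ?_ hs)
  exact (finrank_range_le_card (R := ℂ) fun i => fiber (Φ i) ω).trans_eq (Fintype.card_fin s)

include hn hgap in
/-- A space of length `≤ n` whose fiber spaces capture the `n` largest eigenvalues is the unique
optimal space. -/
theorem isOptimal_of_capturedEnergy_eq {Φ : Fin n → L2 d}
    (hΦ : ∀ᵐ ω ∂cubeMeasure d,
      capturedEnergy f Φ ω = ∑ a : Fin n, eigenvalue f ω (Fin.castLE hnm.le a)) :
    IsOptimal f n (shiftInvariantSpace Φ) ∧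
      ∀ V', IsOptimal f n V' → V' = shiftInvariantSpace Φ := by
  have hbest := ae_exists_best_fiberSpan hn hnm f hgap
  have hle : ∀ (s : ℕ) (_ : s ≤ n) (Ψ : Fin s → L2 d),
      capturedEnergy f Ψ ≤ᵐ[cubeMeasure d] capturedEnergy f Φ := by
    intro s hs Ψ
    filter_upwards [hbest, hΦ] with ω ⟨K₀, h1⟩ h2
    rw [h2]
    exact (h1 s hs Ψ).1
  have hopt : IsOptimal f n (shiftInvariantSpace Φ) := by
    refine ⟨⟨n, le_rfl, Φ, rfl⟩, ?_⟩
    rintro _ ⟨s, hs, Ψ, rfl⟩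
    rw [error_shiftInvariantSpace, error_shiftInvariantSpace]
    exact sub_le_sub_left (integral_mono_ae (integrable_capturedEnergy f Ψ)
      (integrable_capturedEnergy f Φ) (hle s hs Ψ)) _
  refine ⟨hopt, ?_⟩
  rintro _ ⟨⟨s, hs, Ψ, rfl⟩, hmin⟩
  have h1 := le_antisymm (hmin _ hopt.1) (hopt.2 _ ⟨s, hs, Ψ, rfl⟩)
  rw [error_shiftInvariantSpace, error_shiftInvariantSpace, sub_right_inj] at h1
  -- Equal integrals of ordered functions force equality almost everywhere, so both spaces attain
  -- the fiberwise bound.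
  have h2 := (integral_eq_iff_of_ae_le (integrable_capturedEnergy f Ψ)
    (integrable_capturedEnergy f Φ) (hle s hs Ψ)).1 h1
  refine shiftInvariantSpace_eq_of_fiberSpan_eq ?_
  filter_upwards [hbest, hΦ, h2] with ω ⟨K₀, h3⟩ h4 h5
  rw [(h3 s hs Ψ).2 (h5.trans h4), (h3 n le_rfl Φ).2 h4]

/-! ### The generators built from eigenvectors -/

theorem sigmaTilde_add_latticeVec (ω : Space d) (k : Fin d → ℤ) (i : Fin m) :
    sigmaTilde f (ω + latticeVec k) i = sigmaTilde f ω i := by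
  rw [sigmaTilde, sigmaTilde, eigenvalue_congr f (gramian_add_latticeVec f ω k)]

variable (y : Fin n → Space d → EuclideanSpace ℂ (Fin m))

/-- The Fourier transform of the `i`-th generator. -/
def generatorFourier (i : Fin n) (ω : Space d) : ℂ :=
  (sigmaTilde f ω (Fin.castLE hnm.le i) : ℂ) * ∑ j, y i ω j * (𝓕 (f j) : L2 d) ω

/-- The fiber of the `i`-th generator. -/
def generatorFiber (i : Fin n) (ω : Space d) : lp (fun _ : Fin d → ℤ => ℂ) 2 :=
  (sigmaTilde f ω (Fin.castLE hnm.le i) : ℂ) • combination (fun j => fiber (f j) ω) (y i ω)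

variable {f y} (hy : IsEigenvectorChoice f hnm.le y)

include hy

/-- The coefficients are periodic, hence constant along each fiber. -/
theorem generatorFourier_add_latticeVec (i : Fin n) : ∀ᵐ ω ∂cubeMeasure d, ∀ k : Fin d → ℤ,
    generatorFourier hnm f y i (ω + latticeVec k) = generatorFiber hnm f y i ω k := by
  have h1 := ae_restrict_of_ae (s := cube d) (ae_all_iff.2 fun k => hy.periodic i k)
  filter_upwards [h1, ae_all_iff.2 fun j => fiber_apply (f j)] with ω h1 h2 k
  rw [generatorFourier, generatorFiber, sigmaTilde_add_latticeVec, h1 k, combination,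
    lp.coeFn_smul, Pi.smul_apply, lp.coeFn_sum, Finset.sum_apply, smul_eq_mul]
  congr 1
  refine Finset.sum_congr rfl fun j _ => ?_
  rw [lp.coeFn_smul, Pi.smul_apply, h2, smul_eq_mul]

include hgap

theorem generatorFiber_orthonormal : ∀ᵐ ω ∂cubeMeasure d,
    Orthonormal ℂ (fun i => generatorFiber hnm f y i ω) ∧
      ∀ (K : Submodule ℂ (lp (fun _ : Fin d → ℤ => ℂ) 2)) [K.HasOrthogonalProjection],
        Submodule.span ℂ (Set.range fun i => generatorFiber hnm f y i ω) = K →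
          ∑ j, ‖K.starProjection (fiber (f j) ω)‖ ^ 2 =
            ∑ a : Fin n, eigenvalue f ω (Fin.castLE hnm.le a) := by
  filter_upwards [ae_cube_eigenvalue_pos hnm f hgap, gramian_apply f,
    ae_restrict_of_ae hy.orthonormal,
    ae_restrict_of_ae (ae_all_iff.2 hy.left_eigenvector)] with ω h1 h2 h3 h4
  have e : (fun i => generatorFiber hnm f y i ω) = fun a =>
      ((eigenvalue f ω (Fin.castLE hnm.le a) ^ (-(1 / 2) : ℝ) : ℝ) : ℂ) •
        combination (fun j => fiber (f j) ω) (y a ω) := by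
    funext i
    rw [generatorFiber, sigmaTilde, if_neg (h1 i).ne']
  rw [e]
  refine ⟨orthonormal_normalized_combination h2 h1 h4 h3, fun K _ hK => ?_⟩
  exact sum_norm_starProjection_eq_of_left_eigenvectors h2 h1 h4 h3 hK

theorem memLp_generatorFourier (i : Fin n) : MemLp (generatorFourier hnm f y i) 2 volume := by
  have hm : Measurable (generatorFourier hnm f y i) := by
    refine (Complex.measurable_ofReal.comp (measurable_sigmaTilde f _)).mul
      (Finset.measurable_sum _ fun j _ => ?_)
    exact (measurable_toLp_iff.1 (hy.measurable i) j).mul (Lp.stronglyMeasurable _).measurable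
  rw [memLp_two_iff_integrable_sq_norm hm.aestronglyMeasurable]
  have hsq : Integrable fun x => generatorFourier hnm f y i x * generatorFourier hnm f y i x := by
    refine ⟨(hm.mul hm).aestronglyMeasurable, ?_⟩
    rw [hasFiniteIntegral_iff_enorm, ← lintegral_cube_tsum
      (F := fun x => generatorFourier hnm f y i x * generatorFourier hnm f y i x)
      (hm.mul hm).aestronglyMeasurable]
    -- The fibers are unit vectors, so the periodized square has norm sum one, and the integral is
    -- the volume of the cube.
    have hone : ∀ᵐ ω ∂cubeMeasure d, ∑' k : Fin d → ℤ,
        ‖generatorFourier hnm f y i (ω + latticeVec k) *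
          generatorFourier hnm f y i (ω + latticeVec k)‖ₑ = 1 := by
      filter_upwards [generatorFourier_add_latticeVec hnm hy i,
        generatorFiber_orthonormal hnm hgap hy] with ω h1 h2
      have h3 := lp.hasSum_norm (p := 2) (by norm_num) (generatorFiber hnm f y i ω)
      rw [h2.1.1 i] at h3
      simp only [ENNReal.toReal_ofNat, Real.rpow_ofNat, one_pow] at h3
      have h4 : ∀ k : Fin d → ℤ, ‖generatorFourier hnm f y i (ω + latticeVec k) *
          generatorFourier hnm f y i (ω + latticeVec k)‖ₑ =
            ENNReal.ofReal (‖generatorFiber hnm f y i ω k‖ ^ 2) := fun k => by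
        rw [h1 k, ← ofReal_norm, norm_mul, pow_two]
      simp only [h4]
      rw [← ENNReal.ofReal_tsum_of_nonneg (fun _ => by positivity) h3.summable, h3.tsum_eq,
        ENNReal.ofReal_one]
    rw [lintegral_congr_ae hone, lintegral_one]
    -- Finiteness of the cube's volume is read off the trivial character: its integral is `1`, while
    -- the integral of a constant over infinite volume is `0` by convention.
    have h0 := integral_character (0 : Fin d → ℤ)
    refine lt_top_iff_ne_top.2 fun htop => ?_
    have h5 : ∀ ω : Space d, character 0 ω = 1 := fun ω => by
      rw [character, UnitAddTorus.mFourier_zero]; rfl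
    simp only [h5] at h0
    rw [integral_const, measureReal_def, htop] at h0
    simp at h0
  refine hsq.norm.congr (ae_of_all _ fun x => ?_)
  simp only [norm_mul, pow_two]

theorem exists_constructedGenerators : ∃ φ : Fin n → L2 d,
    AreConstructedGenerators f hnm.le y φ ∧
      ∀ i, ∀ᵐ ω ∂cubeMeasure d, fiber (φ i) ω = generatorFiber hnm f y i ω := by
  let F : Fin n → L2 d := fun i => (memLp_generatorFourier hnm hgap hy i).toLp
  have hF : ∀ i, (𝓕 (𝓕⁻ (F i) : L2 d) : L2 d) =ᵐ[volume] generatorFourier hnm f y i := by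
    intro i
    rw [FourierTransform.fourier_fourierInv_eq]
    exact MemLp.coeFn_toLp _
  refine ⟨fun i => 𝓕⁻ (F i), fun i => hF i, fun i => fiber_eq_of_forall ?_⟩
  filter_upwards [ae_iff_ae_cube.1 (hF i), generatorFourier_add_latticeVec hnm hy i]
    with ω h1 h2 k
  rw [h1, h2]

omit hgap hy in
/-- Generators with orthonormal fibers have orthonormal translates. -/
theorem orthonormal_translates {ι : Type*} [Finite ι] {φ : ι → L2 d}
    (h : ∀ᵐ ω ∂cubeMeasure d, Orthonormal ℂ fun i => fiber (φ i) ω) :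
    Orthonormal ℂ (translates φ) := by
  classical
  rw [orthonormal_iff_ite]
  rintro ⟨i, k⟩ ⟨j, l⟩
  rw [translates, translates, inner_translate_eq]
  have e : ∀ᵐ ω ∂cubeMeasure d, character k ω *
      ⟪fiber (φ i) ω, fiber (translate l (φ j)) ω⟫_ℂ =
        character (k - l) ω * if i = j then 1 else 0 := by
    filter_upwards [h, fiber_translate l (φ j)] with ω h1 h2
    rw [h2, inner_smul_right, orthonormal_iff_ite.1 h1, sub_eq_add_neg, character_add, mul_assoc]
  rw [integral_congr_ae e, integral_mul_const, integral_character]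
  by_cases hij : i = j <;> by_cases hkl : k = l <;> simp [hij, hkl, sub_eq_zero]

end Gap

end

end FSIS

open FSIS
theorem theorem2p3 {d m n : ℕ} (hn : 1 ≤ n) (hnm : n < m) (f : Fin m → L2 d)
    (hgap : ∀ᵐ ω : Space d, eigenvalue f ω ⟨n, hnm⟩ < eigenvalue f ω ⟨n - 1, by omega⟩) :
    ∃ V : ClosedSubmodule ℂ (L2 d),
      (IsOptimal f n V ∧ ∀ V' : ClosedSubmodule ℂ (L2 d), IsOptimal f n V' → V' = V) ∧
      (∀ᵐ ω : Space d, n ≤ (gramian f ω).rank) ∧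
      (∃ y : Fin n → Space d → EuclideanSpace ℂ (Fin m), IsEigenvectorChoice f hnm.le y) ∧
      (∀ y : Fin n → Space d → EuclideanSpace ℂ (Fin m), IsEigenvectorChoice f hnm.le y →
        ∃ φ : Fin n → L2 d, AreConstructedGenerators f hnm.le y φ ∧
          TranslatesAreOrthonormalBasis φ V) := by
  have key : ∀ y : Fin n → Space d → EuclideanSpace ℂ (Fin m), IsEigenvectorChoice f hnm.le y →
      ∃ φ : Fin n → L2 d, AreConstructedGenerators f hnm.le y φ ∧
        Orthonormal ℂ (translates φ) ∧ IsOptimal f n (shiftInvariantSpace φ) ∧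
          ∀ V', IsOptimal f n V' → V' = shiftInvariantSpace φ := by
    intro y hy
    obtain ⟨φ, hφ, hfib⟩ := exists_constructedGenerators hnm hgap hy
    have hfib' := ae_all_iff.2 hfib
    have ho := generatorFiber_orthonormal hnm hgap hy
    refine ⟨φ, hφ, orthonormal_translates ?_, isOptimal_of_capturedEnergy_eq hn hnm f hgap ?_⟩
    · filter_upwards [hfib', ho] with ω h1 h2
      simpa only [h1] using h2.1
    · filter_upwards [hfib', ho] with ω h1 h2
      exact h2.2 (fiberSpan φ ω) (by simp only [fiberSpan, h1])
  -- One choice of eigenvectors fixes `V`; any other choice also yields an optimal space, which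
  -- uniqueness identifies with `V`.
  obtain ⟨y₀, hy₀⟩ := exists_eigenvectorChoice f hnm.le
  obtain ⟨φ₀, -, -, hopt, huniq⟩ := key y₀ hy₀
  refine ⟨shiftInvariantSpace φ₀, ⟨hopt, huniq⟩, ae_le_rank_gramian hnm f hgap, ⟨y₀, hy₀⟩, ?_⟩
  intro y hy
  obtain ⟨φ, hφ, hon, hopt', -⟩ := key y hy
  exact ⟨φ, hφ, hon, huniq _ hopt'⟩
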